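/- Let $n\in\{1,2,3\}$, let $0\le\lambda<1$ (the mass ratio $m/M$ of a light and a heavy particle) and let $c\in\mathbb R$ be an interaction parameter. All one-particle spaces are $L^2(\mathbb R^n)$ in the momentum representation; the first factor of $L^2(\mathbb R^n)\otimes L^2(\mathbb R^n)=L^2(\mathbb R^n\times\mathbb R^n)$ is the heavy particle (momentum $K$), the second the light particle (momentum $k$), and $P$ is the vector of momentum operators (multiplication by $p$). Put $K_{cm}=K+k$ and $k_d=\frac{k-\lambda K}{1+\lambda}$. With $a=\frac{\lambda}{1+\lambda}c$, let $$S_\lambda(r)=\frac{-ia}{r+\frac i2a}\ (n=1),\qquad S_\lambda(r)=\frac{-i\pi}{a^{-1}+\gamma+\ln\frac r2+\frac{i\pi}2}\ (n=2),\qquad S_\lambda(r)=\frac{-2ir}{a^{-1}+ir}\ (n=3)$$ ($\gamma$ is the Euler–Mascheroni constant; $S_\lambda=0$ if $a=0$). Let the scattering operator of the point interaction be $$\mathbf S_\lambda=I+I_{cm}\otimes\big(S_\lambda(r)\otimes|\phi\rangle\langle\phi|\big),$$ where the second tensor factor is the space of functions of $k_d$, decomposed in polar coordinates as $L^2((0,\infty),r^{n-1}dr)\otimes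 L^2(S^{n-1})$, and $\phi$ is the normalized constant function on $S^{n-1}$. Put $\mathbf A_\lambda=\mathbf S_\lambda-I$. Let $\rho=\sum_{j}\beta_j|f_j\rangle\langle f_j|$ be the spectral decomposition of a positive trace-class operator on $L^2(\mathbb R^n)$ (for instance a density matrix): $(f_j)_{j\in\mathbb N}$ is orthonormal, $\beta_j\ge0$ and $\sum_j\beta_j<\infty$. Let $G$ be a bounded operator on $L^2(\mathbb R^n)$. For $\vec k\in\mathbb R^n$ and $\sigma\in SO_n$ define $$U_{\vec k,\sigma,\lambda}=\tau_{\vec k}^*\,D_{\frac{I+\lambda\sigma}{1+\lambda}}\,\tau_{\sigma\vec k},\qquad (\tau_{\vec a}f)(p)=f(p-\vec a),\qquad (D_Af)(p)=|\det A|^{1/2}f(Ap),$$ and let $m_{j,\vec k,\sigma,\lambda}$ be the function $$m_{j,\vec k,\sigma,\lambda}=\sqrt{\beta_j}\,\det\Big(\frac{I+\lambda\sigma}{1+\lambda}\Big)^{-1/2}f_j\Big(\vec k+\frac{\sigma-I}{1+\lambda}(\vec k-\lambda P)\Big)$$ of the momentum operator, with its maximal domain. Then $$\mathrm{Tr}_2\big[(I\otimes\rho)\mathbf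 A_\lambda^*(G\otimes I)\mathbf A_\lambda\big]=\sum_j\int_{\mathbb R^n}d\vec k\int_{SO_n\times SO_n}d\sigma_1\,d\sigma_2\;U^*_{\vec k,\sigma_1,\lambda}\,m^*_{j,\vec k,\sigma_1,\lambda}\,\bar S_\lambda\Big(\Big|\frac{\vec k-\lambda P}{1+\lambda}\Big|\Big)\,G\,S_\lambda\Big(\Big|\frac{\vec k-\lambda P}{1+\lambda}\Big|\Big)\,m_{j,\vec k,\sigma_2,\lambda}\,U_{\vec k,\sigma_2,\lambda}.$$ Here $d\sigma$ is the Haar measure of total mass $1$, and for $n=1$ the group $SO_n$ is replaced by $\{+1,-1\}$. The right-hand side is a strongly convergent integral of sesquilinear forms, in the following sense. For every $j$, every $\sigma$ and every $w\in L^2(\mathbb R^n)$, the vector $U_{\vec k,\sigma,\lambda}w$ lies in the domain of $m_{j,\vec k,\sigma,\lambda}$ for almost every $\vec k$. The integrand is the form $(v,w)\mapsto\langle S_\lambda m_{j,\vec k,\sigma_1,\lambda}U_{\vec k,\sigma_1,\lambda}v,\;G\,S_\lambda m_{j,\vec k,\sigma_2,\lambda}U_{\vec k,\sigma_2,\lambda}w\rangle$.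 For all $v,w$ it is absolutely integrable over $(j,\vec k,\sigma_1,\sigma_2)$, and its integral is the matrix element $\langle v,\cdot\,w\rangle$ of the left-hand side. For every increasing sequence of measurable sets exhausting the parameter space, the integrals over these sets define bounded operators that converge strongly to the left-hand side. -/

import Mathlib

open MeasureTheory Filter Topology Complex
open scoped ENNReal InnerProductSpace TensorProduct

noncomputable section

namespace PointScattering

/-! ### Square-integrable functions and Hilbert tensor products

`L²(X × Y)` is used as the Hilbert-space tensor product of `L²(X)` and `L²(Y)`. -/

/-- The complex Hilbert space `L²(μ)`. -/
abbrev L2 {X : Type} [MeasurableSpace X] (μ : Measure X) : Type := Lp ℂ 2 μ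

section Tensor

variable {X Y : Type} [MeasurableSpace X] [MeasurableSpace Y]
  (μ : Measure X) (ν : Measure Y) [SigmaFinite μ] [SigmaFinite ν]

theorem memLp_tmul (v : L2 μ) (f : L2 ν) :
    MemLp (fun z : X × Y => v z.1 * f z.2) 2 (μ.prod ν) := by
  have hv := Lp.memLp v
  have hf := Lp.memLp f
  have hm : AEStronglyMeasurable (fun z : X × Y => v z.1 * f z.2) (μ.prod ν) :=
    hv.1.comp_fst.mul hf.1.comp_snd
  rw [memLp_two_iff_integrable_sq_norm hm]
  have h1 := (memLp_two_iff_integrable_sq_norm hv.1).1 hv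
  have h2 := (memLp_two_iff_integrable_sq_norm hf.1).1 hf
  simpa [mul_pow] using h1.mul_prod h2

/-- The product vector `v ⊗ f`, i.e. the function `(x, y) ↦ v x * f y`. -/
def tmul (v : L2 μ) (f : L2 ν) : L2 (μ.prod ν) := (memLp_tmul μ ν v f).toLp _

theorem coeFn_tmul (v : L2 μ) (f : L2 ν) :
    tmul μ ν v f =ᵐ[μ.prod ν] fun z => v z.1 * f z.2 := MemLp.coeFn_toLp _

/-- `(v, f) ↦ v ⊗ f` as a bilinear map. -/
def tmulₗ : L2 μ →ₗ[ℂ] L2 ν →ₗ[ℂ] L2 (μ.prod ν) :=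
  LinearMap.mk₂ ℂ (tmul μ ν)
    (fun v v' f => by
      apply Lp.ext
      have h := (Measure.quasiMeasurePreserving_fst (μ := μ) (ν := ν)).ae_eq_comp
        (Lp.coeFn_add v v')
      filter_upwards [coeFn_tmul μ ν (v + v') f, coeFn_tmul μ ν v f, coeFn_tmul μ ν v' f,
        Lp.coeFn_add (tmul μ ν v f) (tmul μ ν v' f), h] with z h1 h2 h3 h4 h5
      simp only [Function.comp_apply, Pi.add_apply] at h5
      rw [h1, h4, Pi.add_apply, h2, h3, h5, add_mul])
    (fun c v f => by
      apply Lp.ext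
      have h := (Measure.quasiMeasurePreserving_fst (μ := μ) (ν := ν)).ae_eq_comp
        (Lp.coeFn_smul c v)
      filter_upwards [coeFn_tmul μ ν (c • v) f, coeFn_tmul μ ν v f,
        Lp.coeFn_smul c (tmul μ ν v f), h] with z h1 h2 h4 h5
      simp only [Function.comp_apply, Pi.smul_apply, smul_eq_mul] at h5
      rw [h1, h4, Pi.smul_apply, h2, h5, smul_eq_mul, mul_assoc])
    (fun v f f' => by
      apply Lp.ext
      have h := (Measure.quasiMeasurePreserving_snd (μ := μ) (ν := ν)).ae_eq_comp
        (Lp.coeFn_add f f')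
      filter_upwards [coeFn_tmul μ ν v (f + f'), coeFn_tmul μ ν v f, coeFn_tmul μ ν v f',
        Lp.coeFn_add (tmul μ ν v f) (tmul μ ν v f'), h] with z h1 h2 h3 h4 h5
      simp only [Function.comp_apply, Pi.add_apply] at h5
      rw [h1, h4, Pi.add_apply, h2, h3, h5, mul_add])
    (fun c v f => by
      apply Lp.ext
      have h := (Measure.quasiMeasurePreserving_snd (μ := μ) (ν := ν)).ae_eq_comp
        (Lp.coeFn_smul c f)
      filter_upwards [coeFn_tmul μ ν v (c • f), coeFn_tmul μ ν v f,
        Lp.coeFn_smul c (tmul μ ν v f), h] with z h1 h2 h4 h5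
      simp only [Function.comp_apply, Pi.smul_apply, smul_eq_mul] at h5
      rw [h1, h4, Pi.smul_apply, h2, h5, smul_eq_mul, mul_left_comm])

theorem inner_tmul_tmul (v v' : L2 μ) (f f' : L2 ν) :
    ⟪tmul μ ν v f, tmul μ ν v' f'⟫_ℂ = ⟪v, v'⟫_ℂ * ⟪f, f'⟫_ℂ := by
  simp only [L2.inner_def]
  rw [← integral_prod_mul]
  apply integral_congr_ae
  filter_upwards [coeFn_tmul μ ν v f, coeFn_tmul μ ν v' f'] with z h1 h2
  rw [h1, h2]
  simp only [RCLike.inner_apply, map_mul]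
  ring

/-- The canonical isometry of the algebraic tensor product `L²(μ) ⊗ L²(ν)` into
`L²(μ × ν)`. -/
def tensorEmb : (L2 μ ⊗[ℂ] L2 ν) →ₗᵢ[ℂ] L2 (μ.prod ν) :=
  (TensorProduct.lift (tmulₗ μ ν)).isometryOfInner (fun x y => by
    refine x.induction_on (by simp) (fun v f => ?_) (fun a b ha hb => ?_)
    · refine y.induction_on (by simp) (fun v' f' => ?_) (fun a b ha hb => ?_)
      · simpa [tmulₗ] using inner_tmul_tmul μ ν v v' f f'
      · simp only [map_add, inner_add_right, ha, hb]
    · simp only [map_add, inner_add_left, ha, hb])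

@[simp] theorem tensorEmb_tmul (v : L2 μ) (f : L2 ν) :
    tensorEmb μ ν (v ⊗ₜ[ℂ] f) = tmul μ ν v f := by
  simp [tensorEmb, tmulₗ]

theorem denseRange_tensorEmb : DenseRange (tensorEmb μ ν) := by
  have key : (LinearMap.range (tensorEmb μ ν).toLinearMap).topologicalClosure = ⊤ := by
    rw [Submodule.topologicalClosure_eq_top_iff, Submodule.eq_bot_iff]
    intro Ψ hΨ
    rw [Submodule.mem_orthogonal] at hΨ
    have hrect : ∀ s : Set X, ∀ t : Set Y, MeasurableSet s → MeasurableSet t → μ s ≠ ∞ →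
        ν t ≠ ∞ → ∫ z in s ×ˢ t, Ψ z ∂(μ.prod ν) = 0 := by
      intro s t hs ht hμ hν
      have h0 := hΨ (tmul μ ν (indicatorConstLp 2 hs hμ 1) (indicatorConstLp 2 ht hν 1))
        ⟨_, tensorEmb_tmul μ ν _ _⟩
      rw [L2.inner_def] at h0
      rw [← h0, ← integral_indicator (hs.prod ht)]
      apply integral_congr_ae
      have h1 := (Measure.quasiMeasurePreserving_fst (μ := μ) (ν := ν)).ae_eq_comp
        (indicatorConstLp_coeFn (p := 2) (hs := hs) (hμs := hμ) (c := (1 : ℂ)))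
      have h2 := (Measure.quasiMeasurePreserving_snd (μ := μ) (ν := ν)).ae_eq_comp
        (indicatorConstLp_coeFn (p := 2) (hs := ht) (hμs := hν) (c := (1 : ℂ)))
      filter_upwards [coeFn_tmul μ ν (indicatorConstLp 2 hs hμ 1) (indicatorConstLp 2 ht hν 1),
        h1, h2] with z h3 h4 h5
      simp only [Function.comp_apply] at h4 h5
      rw [h3, h4, h5]
      by_cases ha : z.1 ∈ s <;> by_cases hb : z.2 ∈ t <;>
        simp [Set.indicator, Set.mem_prod, ha, hb]
    have hloc : ∀ N : ℕ, Ψ =ᵐ[(μ.prod ν).restrict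
        (spanningSets μ N ×ˢ spanningSets ν N)] 0 := by
      intro N
      set K := spanningSets μ N ×ˢ spanningSets ν N with hK
      have hs := measurableSet_spanningSets μ N
      have ht := measurableSet_spanningSets ν N
      have hKm : MeasurableSet K := hs.prod ht
      have hKfin : (μ.prod ν) K < ∞ := by
        rw [hK, Measure.prod_prod]
        exact ENNReal.mul_lt_top (measure_spanningSets_lt_top μ N)
          (measure_spanningSets_lt_top ν N)
      have : IsFiniteMeasure ((μ.prod ν).restrict K) := ⟨by simpa using hKfin⟩
      have hint : Integrable Ψ ((μ.prod ν).restrict K) :=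
        ((Lp.memLp Ψ).restrict K).integrable (by norm_num)
      apply hint.ae_eq_zero_of_forall_setIntegral_eq_zero
      intro S hS _
      induction S, hS using MeasurableSpace.induction_on_inter
          generateFrom_prod.symm isPiSystem_prod with
      | empty => simp
      | basic S hS =>
        obtain ⟨s, hs', t, ht', rfl⟩ := hS
        have hs' : MeasurableSet s := hs'
        have ht' : MeasurableSet t := ht'
        rw [Measure.restrict_restrict (hs'.prod ht'), hK, Set.prod_inter_prod]
        exact hrect _ _ (hs'.inter hs) (ht'.inter ht)
          ((measure_mono Set.inter_subset_right).trans_lt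
            (measure_spanningSets_lt_top μ N)).ne
          ((measure_mono Set.inter_subset_right).trans_lt
            (measure_spanningSets_lt_top ν N)).ne
      | compl S hS ih =>
        have hu : ∫ z in K, Ψ z ∂(μ.prod ν) = 0 :=
          hrect _ _ hs ht (measure_spanningSets_lt_top μ N).ne
            (measure_spanningSets_lt_top ν N).ne
        have := integral_add_compl hS hint
        rw [ih (by simp), zero_add, hu] at this
        exact this
      | iUnion S hd hS ih =>
        rw [integral_iUnion hS hd hint.integrableOn]
        simp [fun i => ih i (by simp)]
    apply Lp.ext
    have hae : ∀ᵐ z ∂(μ.prod ν), ∀ N : ℕ,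
        z ∈ spanningSets μ N ×ˢ spanningSets ν N → Ψ z = 0 := by
      rw [ae_all_iff]
      intro N
      have := hloc N
      rwa [Filter.EventuallyEq, ae_restrict_iff' ((measurableSet_spanningSets μ N).prod
        (measurableSet_spanningSets ν N))] at this
    filter_upwards [hae, Lp.coeFn_zero ℂ 2 (μ.prod ν)] with z hz h0
    rw [h0]
    obtain ⟨a, ha⟩ := Set.mem_iUnion.1 (by rw [iUnion_spanningSets]; trivial :
      z.1 ∈ ⋃ i, spanningSets μ i)
    obtain ⟨b, hb⟩ := Set.mem_iUnion.1 (by rw [iUnion_spanningSets]; trivial :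
      z.2 ∈ ⋃ i, spanningSets ν i)
    exact hz (max a b) ⟨monotone_spanningSets μ (le_max_left a b) ha,
      monotone_spanningSets ν (le_max_right a b) hb⟩
  have := Submodule.dense_iff_topologicalClosure_eq_top.2 key
  exact this

/-- The tensor product `G ⊗ R` of bounded operators: the bounded operator on `L²(μ × ν)`
with `(G ⊗ R)(v ⊗ f) = G v ⊗ R f`. -/
def tensorOp (G : L2 μ →L[ℂ] L2 μ) (R : L2 ν →L[ℂ] L2 ν) :
    L2 (μ.prod ν) →L[ℂ] L2 (μ.prod ν) :=
  ((tensorEmb μ ν).toContinuousLinearMap ∘L TensorProduct.mapL G R).extend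
    (tensorEmb μ ν).toContinuousLinearMap

theorem tensorOp_tmul (G : L2 μ →L[ℂ] L2 μ) (R : L2 ν →L[ℂ] L2 ν) (v : L2 μ) (f : L2 ν) :
    tensorOp μ ν G R (tmul μ ν v f) = tmul μ ν (G v) (R f) := by
  have h := ContinuousLinearMap.extend_eq
    ((tensorEmb μ ν).toContinuousLinearMap ∘L TensorProduct.mapL G R)
    (e := (tensorEmb μ ν).toContinuousLinearMap) (denseRange_tensorEmb μ ν)
    (tensorEmb μ ν).isometry.isUniformInducing (v ⊗ₜ[ℂ] f)
  have h2 : (tensorEmb μ ν).toContinuousLinearMap (v ⊗ₜ[ℂ] f) = tmul μ ν v f :=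
    tensorEmb_tmul μ ν v f
  rw [h2] at h
  exact h.trans (tensorEmb_tmul μ ν (G v) (R f))

/-- `Y` is the partial trace `Tr₂ T` over the second tensor factor:
`⟨v, Y w⟩ = ∑ₗ ⟨v ⊗ eₗ, T (w ⊗ eₗ)⟩` for all `v, w` and every orthonormal basis `(eₗ)`
of the second factor. -/
def IsPartialTrace (T : L2 (μ.prod ν) →L[ℂ] L2 (μ.prod ν)) (Y : L2 μ →L[ℂ] L2 μ) : Prop :=
  ∀ (ι : Type) (e : HilbertBasis ι ℂ (L2 ν)) (v w : L2 μ),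
    HasSum (fun l => ⟪tmul μ ν v (e l), T (tmul μ ν w (e l))⟫_ℂ) ⟪v, Y w⟫_ℂ

end Tensor

/-! ### Operators on a single copy of `L²(ℝⁿ)`, in the momentum representation -/

/-- Momentum space `ℝⁿ`. -/
abbrev E (n : ℕ) : Type := EuclideanSpace ℝ (Fin n)

/-- Lebesgue measure on `ℝⁿ`. -/
abbrev leb (n : ℕ) : Measure (E n) := volume

/-- The Hilbert space `L²(ℝⁿ)` of one particle, in the momentum representation. -/
abbrev H (n : ℕ) : Type := L2 (leb n)

/-- The Hilbert space `L²(ℝⁿ × ℝⁿ)` of two particles, in the momentum representation. -/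
abbrev H₂ (n : ℕ) : Type := L2 ((leb n).prod (leb n))

open Classical in
/-- The element of `L²` given by a square-integrable function; `0` if the function is not
square-integrable. -/
def toL2 {n : ℕ} (g : E n → ℂ) : H n := if h : MemLp g 2 (leb n) then h.toLp g else 0

/-- Shift of momentum: `(τ_a f)(p) = f (p - a)`. -/
def shift {n : ℕ} (a : E n) : H n →L[ℂ] H n :=
  (Lp.compMeasurePreservingₗᵢ ℂ (fun p : E n => p - a)
    (measurePreserving_sub_right volume a)).toContinuousLinearMap

/-- The action of a real matrix on `ℝⁿ`. -/
abbrev act {n : ℕ} (A : Matrix (Fin n) (Fin n) ℝ) (p : E n) : E n :=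
  Matrix.toEuclideanCLM (n := Fin n) (𝕜 := ℝ) A p

/-- Dilation: `(D_A f)(p) = |det A|^{1/2} f (A p)`, for `A` invertible. -/
def dilation {n : ℕ} (A : Matrix (Fin n) (Fin n) ℝ) (f : H n) : H n :=
  toL2 fun p => (Real.sqrt |A.det| : ℂ) * f (act A p)

theorem memLp_dilation {n : ℕ} (A : Matrix (Fin n) (Fin n) ℝ) (hA : A.det ≠ 0) (f : H n) :
    MemLp (fun p => (Real.sqrt |A.det| : ℂ) * f (act A p)) 2 (leb n) := by
  apply MemLp.const_mul
  have hdet : LinearMap.det (Matrix.toEuclideanCLM (n := Fin n) (𝕜 := ℝ) A).toLinearMap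
      = A.det := by
    change LinearMap.det (Matrix.toLpLin 2 2 A) = A.det
    rw [Matrix.toLpLin_eq_toLin, LinearMap.det_toLin]
  have hmap : (leb n).map (fun p => act A p) = ENNReal.ofReal |(A.det)⁻¹| • leb n := by
    have h := Measure.map_linearMap_addHaar_eq_smul_addHaar (leb n)
      (f := (Matrix.toEuclideanCLM (n := Fin n) (𝕜 := ℝ) A).toLinearMap) (by rwa [hdet])
    rw [hdet] at h
    exact h
  have hf : MemLp f 2 ((leb n).map (fun p => act A p)) := by
    rw [hmap]
    exact (Lp.memLp f).smul_measure ENNReal.ofReal_ne_top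
  exact hf.comp_of_map (Matrix.toEuclideanCLM (n := Fin n) (𝕜 := ℝ) A).continuous.aemeasurable

/-- Membership in the domain `{ψ | g ψ ∈ L²}` of the function `g(P)` of the momentum operator. -/
def InMulDomain {n : ℕ} (g : E n → ℂ) (ψ : H n) : Prop :=
  MemLp (fun p => g p * ψ p) 2 (leb n)

/-- The function `g(P)` of the momentum operator: multiplication by `g` on its maximal domain
`{ψ | g ψ ∈ L²}` (and `0` on vectors outside that domain). -/
def mulOp {n : ℕ} (g : E n → ℂ) (ψ : H n) : H n := toL2 fun p => g p * ψ p

/-! ### The rotation group and its normalised Haar measure -/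

/-- The rotations: `SO(n)` for `n ≥ 2`, and `{+1, -1} = O(1)` for `n = 1`. -/
def rotations (n : ℕ) : Subgroup (Matrix.orthogonalGroup (Fin n) ℝ) where
  carrier := {σ | n = 1 ∨ (σ : Matrix (Fin n) (Fin n) ℝ).det = 1}
  one_mem' := by simp
  mul_mem' := by
    rintro a b (ha | ha) (hb | hb)
    · exact Or.inl ha
    · exact Or.inl ha
    · exact Or.inl hb
    · right
      simp [ha, hb]
  inv_mem' := by
    rintro a (ha | ha)
    · exact Or.inl ha
    · right
      have h : ((a⁻¹ : Matrix.orthogonalGroup (Fin n) ℝ) : Matrix (Fin n) (Fin n) ℝ)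
        = star (a : Matrix (Fin n) (Fin n) ℝ) := rfl
      rw [h, Matrix.star_eq_conjTranspose, Matrix.det_conjTranspose, ha]
      simp

/-- The matrix of a rotation. -/
abbrev rotMat {n : ℕ} (σ : rotations n) : Matrix (Fin n) (Fin n) ℝ :=
  ((σ : Matrix.orthogonalGroup (Fin n) ℝ) : Matrix (Fin n) (Fin n) ℝ)

instance (n : ℕ) : MeasurableSpace (rotations n) := borel _

instance (n : ℕ) : BorelSpace (rotations n) := ⟨rfl⟩

theorem isEmbedding_rotMat (n : ℕ) : IsEmbedding (rotMat (n := n)) :=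
  IsEmbedding.subtypeVal.comp IsEmbedding.subtypeVal

instance (n : ℕ) : CompactSpace (rotations n) := by
  rw [← isCompact_univ_iff, (isEmbedding_rotMat n).isCompact_iff, Set.image_univ]
  have hrange : Set.range (rotMat (n := n)) =
      {M | M * star M = 1 ∧ (n = 1 ∨ M.det = 1)} := by
    ext M
    constructor
    · rintro ⟨σ, rfl⟩
      exact ⟨Matrix.mem_orthogonalGroup_iff _ _ |>.1 σ.1.2, σ.2⟩
    · rintro ⟨h1, h2⟩
      exact ⟨⟨⟨M, (Matrix.mem_orthogonalGroup_iff _ _).2 h1⟩, h2⟩, rfl⟩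
  have hclosed : IsClosed (Set.range (rotMat (n := n))) := by
    rw [hrange]
    refine IsClosed.inter ?_ ?_
    · exact isClosed_eq (continuous_id.mul continuous_star) continuous_const
    · by_cases hn : n = 1
      · simp only [hn, true_or]
        exact isClosed_univ
      · simp only [hn, false_or]
        exact isClosed_eq (continuous_id.matrix_det) continuous_const
  have hbox : IsCompact (Set.univ.pi fun _ : Fin n => Set.univ.pi fun _ : Fin n =>
      Set.Icc (-1 : ℝ) 1) :=
    isCompact_univ_pi fun _ => isCompact_univ_pi fun _ => isCompact_Icc
  refine IsCompact.of_isClosed_subset hbox hclosed ?_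
  rintro _ ⟨σ, rfl⟩ i _ j _
  have := entry_norm_bound_of_unitary (𝕜 := ℝ) σ.1.2 i j
  rw [Real.norm_eq_abs] at this
  exact abs_le.1 this

/-- Haar measure on the rotation group, normalised to total mass `1`. -/
def haarRot (n : ℕ) : Measure (rotations n) := Measure.haarMeasure ⊤

instance (n : ℕ) : IsProbabilityMeasure (haarRot n) :=
  ⟨by simpa [haarRot] using (Measure.haarMeasure_self (K₀ := (⊤ : TopologicalSpace.PositiveCompacts
    (rotations n))))⟩

/-! ### The scattering operator of the point interaction -/

/-- The scattering coefficient `S_λ(k)` in dimensions one, two and three, with interaction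
parameter `c` (the resonance parameter `α₀` if `n = 1`, the scattering length `l₀` if
`n = 2, 3`). Put `a = λ c / (1 + λ)`. Then `S_λ(k)` is
`-i a / (k + i a / 2)` if `n = 1`, `-i π / (a⁻¹ + γ + ln (k/2) + i π / 2)` if `n = 2`, and
`-2 i k / (a⁻¹ + i k)` if `n = 3`. For `n = 2, 3` the fractions are multiplied through by `a`,
so that `a = 0` gives the value `0`. -/
def scatCoeff (n : ℕ) (c lam k : ℝ) : ℂ :=
  let a : ℝ := lam / (1 + lam) * c
  match n with
  | 1 => -I * a / (k + I * (a / 2))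
  | 2 => -I * Real.pi * a /
      (1 + a * (Real.eulerMascheroniConstant + Real.log (k / 2)) + I * (Real.pi / 2) * a)
  | 3 => -2 * I * k * a / (1 + I * k * a)
  | _ => 0

theorem scatCoeff_two (c lam k : ℝ) (h : lam / (1 + lam) * c ≠ 0) :
    scatCoeff 2 c lam k = -I * Real.pi / (((lam / (1 + lam) * c : ℝ) : ℂ)⁻¹ +
      Real.eulerMascheroniConstant + Real.log (k / 2) + I * (Real.pi / 2)) := by
  have h' : ((lam / (1 + lam) * c : ℝ) : ℂ) ≠ 0 := by exact_mod_cast h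
  simp only [scatCoeff]
  generalize ((lam / (1 + lam) * c : ℝ) : ℂ) = a at h'
  rw [← mul_div_mul_right _ (a⁻¹ + Real.eulerMascheroniConstant + Real.log (k / 2) +
    I * (Real.pi / 2)) h']
  congr 1
  field_simp
  ring

theorem scatCoeff_three (c lam k : ℝ) (h : lam / (1 + lam) * c ≠ 0) :
    scatCoeff 3 c lam k = -2 * I * k / (((lam / (1 + lam) * c : ℝ) : ℂ)⁻¹ + I * k) := by
  have h' : ((lam / (1 + lam) * c : ℝ) : ℂ) ≠ 0 := by exact_mod_cast h
  simp only [scatCoeff]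
  generalize ((lam / (1 + lam) * c : ℝ) : ℂ) = a at h'
  rw [← mul_div_mul_right _ (a⁻¹ + I * k) h']
  congr 1
  field_simp

theorem norm_div_le_two (x y : ℝ) : ‖(-2 * I * y) / ((x : ℂ) + I * y)‖ ≤ 2 := by
  rw [norm_div]
  have h : |y| ≤ ‖(x : ℂ) + I * y‖ := by
    have := abs_im_le_norm ((x : ℂ) + I * y)
    simpa using this
  apply div_le_of_le_mul₀ (norm_nonneg _) (by norm_num)
  simp only [norm_mul, norm_neg, Complex.norm_I, Complex.norm_real, Real.norm_eq_abs]
  norm_num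
  exact h

theorem norm_scatCoeff_le (n : ℕ) (c lam k : ℝ) : ‖scatCoeff n c lam k‖ ≤ 2 := by
  unfold scatCoeff
  dsimp only
  generalize lam / (1 + lam) * c = a
  split
  · convert norm_div_le_two k (a / 2) using 2
    push_cast
    ring
  · convert norm_div_le_two (1 + a * (Real.eulerMascheroniConstant + Real.log (k / 2)))
      (Real.pi / 2 * a) using 2
    push_cast
    ring
  · convert norm_div_le_two 1 (k * a) using 2
    push_cast
    ring
  · simp

theorem measurable_scatCoeff (n : ℕ) (c lam : ℝ) : Measurable (scatCoeff n c lam) := by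
  unfold scatCoeff
  dsimp only
  generalize lam / (1 + lam) * c = a
  split <;> fun_prop

/-- The measure `r^{n-1} dr` on `(0, ∞)`. -/
abbrev radialMeasure (n : ℕ) : Measure (Set.Ioi (0 : ℝ)) := Measure.volumeIoiPow (n - 1)

/-- The surface measure on the unit sphere of `ℝⁿ` (counting measure on `{-1, 1}` if `n = 1`). -/
abbrev surfaceMeasure (n : ℕ) : Measure (Metric.sphere (0 : E n) 1) := (leb n).toSphere

theorem memLp_scatCoeff (n : ℕ) (c lam : ℝ) :
    MemLp (fun r : Set.Ioi (0 : ℝ) => scatCoeff n c lam r) ∞ (radialMeasure n) :=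
  memLp_top_of_bound
    ((measurable_scatCoeff n c lam).comp measurable_subtype_coe).aestronglyMeasurable 2
    (Eventually.of_forall fun _ => norm_scatCoeff_le _ _ _ _)

/-- Multiplication by `S_λ(r)` on `L²((0, ∞), r^{n-1} dr)`. -/
def radialScat (n : ℕ) (c lam : ℝ) : L2 (radialMeasure n) →L[ℂ] L2 (radialMeasure n) :=
  (ContinuousLinearMap.mul ℂ ℂ).holderL (radialMeasure n) ∞ 2 2 ((memLp_scatCoeff n c lam).toLp _)

/-- The normalised constant function `φ = s_n^{-1/2}` on the unit sphere, where `s_n` is the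
area of the sphere. -/
def sphereConst (n : ℕ) : L2 (surfaceMeasure n) :=
  Lp.const 2 (surfaceMeasure n) (((Real.sqrt ((surfaceMeasure n).real Set.univ))⁻¹ : ℝ) : ℂ)

theorem measurePreserving_polar (n : ℕ) [NeZero n] :
    MeasurePreserving (fun z : Metric.sphere (0 : E n) 1 × Set.Ioi (0 : ℝ) => z.2.1 • z.1.1)
      ((surfaceMeasure n).prod (radialMeasure n)) (leb n) := by
  have h1 := (leb n).measurePreserving_homeomorphUnitSphereProd
  rw [finrank_euclideanSpace_fin] at h1
  have h2 := h1.symm (homeomorphUnitSphereProd (E n)).toMeasurableEquiv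
  have h3 : MeasurePreserving (Subtype.val : ({0}ᶜ : Set (E n)) → E n)
      ((leb n).comap Subtype.val) (leb n) := by
    refine ⟨measurable_subtype_coe, ?_⟩
    rw [map_comap_subtype_coe (measurableSet_singleton _).compl]
    rw [Measure.restrict_eq_self_of_ae_mem]
    rw [ae_iff]
    simp
  exact h3.comp h2

/-- Polar coordinates: the unitary `L²(ℝⁿ) → L²(S^{n-1}) ⊗ L²((0, ∞), r^{n-1} dr)`,
`f ↦ ((ω, r) ↦ f (r ω))`. -/
def polar (n : ℕ) [NeZero n] : H n →L[ℂ] L2 ((surfaceMeasure n).prod (radialMeasure n)) :=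
  (Lp.compMeasurePreservingₗᵢ ℂ _ (measurePreserving_polar n)).toContinuousLinearMap

/-- The operator `S_λ(k) ⊗ |φ⟩⟨φ|` on `L²(ℝⁿ)`, decomposed into a radial and an angular part. -/
def sWave (n : ℕ) [NeZero n] (c lam : ℝ) : H n →L[ℂ] H n :=
  ContinuousLinearMap.adjoint (polar n) ∘L
    tensorOp (surfaceMeasure n) (radialMeasure n)
      (InnerProductSpace.rankOne ℂ (sphereConst n) (sphereConst n)) (radialScat n c lam) ∘L
    polar n

/-- For mass ratio `λ`, the centre-of-mass momentum `K_cm = K + k` and the momentum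
`k_d = (k - λ K) / (1 + λ)` of the displacement coordinate determine the momenta `K` of the heavy
and `k` of the light particle: `K = K_cm / (1 + λ) - k_d`, `k = k_d + λ K_cm / (1 + λ)`.
This is the map `(K_cm, k_d) ↦ (K, k)`. -/
def fromCM (n : ℕ) (lam : ℝ) (z : E n × E n) : E n × E n :=
  ((1 + lam)⁻¹ • z.1 - z.2, z.2 + (lam / (1 + lam)) • z.1)

theorem fromCM_spec (n : ℕ) (lam : ℝ) (h : 1 + lam ≠ 0) (K k : E n) :
    fromCM n lam (K + k, (1 + lam)⁻¹ • (k - lam • K)) = (K, k) := by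
  ext i <;> simp [fromCM] <;> field_simp <;> ring

theorem measurePreserving_fromCM (n : ℕ) (lam : ℝ) (h : 1 + lam ≠ 0) :
    MeasurePreserving (fromCM n lam) ((leb n).prod (leb n)) ((leb n).prod (leb n)) := by
  have h1 : MeasurePreserving (fun z : E n × E n => (z.1, z.2 + (lam / (1 + lam)) • z.1))
      ((leb n).prod (leb n)) ((leb n).prod (leb n)) :=
    MeasurePreserving.skew_product (g := fun x y => y + (lam / (1 + lam)) • x)
      (MeasurePreserving.id _) (by fun_prop)
      (Eventually.of_forall fun x => (measurePreserving_add_right (leb n) _).map_eq)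
  have h2 : MeasurePreserving (fun z : E n × E n => (z.1, z.2 - z.1))
      ((leb n).prod (leb n)) ((leb n).prod (leb n)) :=
    MeasurePreserving.skew_product (g := fun x y => y - x)
      (MeasurePreserving.id _) (by fun_prop)
      (Eventually.of_forall fun x => (measurePreserving_sub_right (leb n) _).map_eq)
  have hs : MeasurePreserving (Prod.swap : E n × E n → E n × E n)
      ((leb n).prod (leb n)) ((leb n).prod (leb n)) := Measure.measurePreserving_swap
  have := hs.comp (h2.comp (hs.comp h1))
  convert this using 1
  ext z i
  · simp [fromCM]
    field_simp
    ring
  · simp [fromCM]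

/-- The unitary from the momentum coordinates `(K, k)` of the heavy and the light particle to the
momentum coordinates `(K_cm, k_d)`. -/
def toCM (n : ℕ) (lam : ℝ) (h : 0 ≤ lam) : H₂ n →L[ℂ] H₂ n :=
  (Lp.compMeasurePreservingₗᵢ ℂ _ (measurePreserving_fromCM n lam (by positivity))).toContinuousLinearMap

/-- The scattering operator `𝐒_λ = I + I_cm ⊗ (S_λ(k) ⊗ |φ⟩⟨φ|)` of the point interaction, as an
operator on the two-particle space (first factor heavy, second factor light). -/
def scatOp (n : ℕ) [NeZero n] (c lam : ℝ) (h : 0 ≤ lam) : H₂ n →L[ℂ] H₂ n :=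
  ContinuousLinearMap.adjoint (toCM n lam h) ∘L
    (1 + tensorOp (leb n) (leb n) 1 (sWave n c lam)) ∘L toCM n lam h

/-- `𝐀_λ = 𝐒_λ - I`. -/
def transOp (n : ℕ) [NeZero n] (c lam : ℝ) (h : 0 ≤ lam) : H₂ n →L[ℂ] H₂ n :=
  scatOp n c lam h - 1

/-! ### The operators under the integral -/

/-- The matrix `(I + λ σ) / (1 + λ)`. -/
def mixMat {n : ℕ} (lam : ℝ) (σ : rotations n) : Matrix (Fin n) (Fin n) ℝ :=
  (1 + lam)⁻¹ • (1 + lam • rotMat σ)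

/-- `U_{k,σ,λ} = τ_k^* D_{(I + λσ)/(1 + λ)} τ_{σ k}`. -/
def opU {n : ℕ} (lam : ℝ) (k : E n) (σ : rotations n) (w : H n) : H n :=
  ContinuousLinearMap.adjoint (shift k) (dilation (mixMat lam σ) (shift (act (rotMat σ) k) w))

/-- The function `p ↦ √β det((I + λσ)/(1 + λ))^{-1/2} f(k + (σ - I)(k - λ p)/(1 + λ))`; the
operator `m_{j,k,σ,λ}` is this function of the momentum operator, for `β = β_j`, `f = f_j`. -/
def symbM {n : ℕ} (lam : ℝ) (β : ℝ) (f : H n) (k : E n) (σ : rotations n) (p : E n) : ℂ :=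
  ((Real.sqrt β * (mixMat lam σ).det ^ (-(1 / 2) : ℝ) : ℝ) : ℂ) *
    f (k + (1 + lam)⁻¹ • act (rotMat σ - 1) (k - lam • p))

/-- The function `p ↦ S_λ(|(k - λ p)/(1 + λ)|)`. -/
def symbS (n : ℕ) (c lam : ℝ) (k p : E n) : ℂ :=
  scatCoeff n c lam ‖(1 + lam)⁻¹ • (k - lam • p)‖

/-- The vector `S_λ(|(k - λP)/(1 + λ)|) m_{j,k,σ,λ} U_{k,σ,λ} w`, for `β = β_j`, `f = f_j`. -/
def opSMU {n : ℕ} (c lam : ℝ) (β : ℝ) (f : H n) (k : E n) (σ : rotations n) (w : H n) : H n :=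
  mulOp (symbS n c lam k) (mulOp (symbM lam β f k σ) (opU lam k σ w))

/-- The measure `∑_j ∫_{ℝⁿ} dk ∫_{SO(n) × SO(n)} dσ₁ dσ₂`. -/
def paramMeasure (n : ℕ) : Measure (ℕ × E n × rotations n × rotations n) :=
  Measure.count.prod ((leb n).prod ((haarRot n).prod (haarRot n)))

/-- The bounded operator `B` is the strongly convergent integral `∫ Q_x dμ(x)` of the
sesquilinear forms `Q_x(v, w)`: all matrix elements are integrable with integral `⟨v, B w⟩`, and
for every exhaustion of the parameter space by an increasing sequence of measurable sets the
integrals over these sets define bounded operators that converge strongly to `B`. -/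
def IsStrongIntegral {X V : Type} [MeasurableSpace X] [NormedAddCommGroup V]
    [InnerProductSpace ℂ V] (μ : Measure X) (Q : X → V → V → ℂ) (B : V →L[ℂ] V) : Prop :=
  (∀ v w : V, Integrable (fun x => Q x v w) μ) ∧
  (∀ v w : V, ⟪v, B w⟫_ℂ = ∫ x, Q x v w ∂μ) ∧
  ∀ F : ℕ → Set X, (∀ N, MeasurableSet (F N)) → Monotone F → (⋃ N, F N) = Set.univ →
    ∃ T : ℕ → V →L[ℂ] V,
      (∀ N (v w : V), ⟪v, T N w⟫_ℂ = ∫ x in F N, Q x v w ∂μ) ∧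
      ∀ w : V, Tendsto (fun N => T N w) atTop (𝓝 (B w))

end PointScattering

end

/-!
The operator `𝐀_λ` is an average over rotations. In polar coordinates the projection `|φ⟩⟨φ|` onto
the constant functions on the sphere is the average over the rotation group, because the group acts
transitively on the sphere and its Haar measure is right invariant (`integral_rotSphere`). Written in
the momenta `(K, k)` of the two particles, a rotation `σ` of `k_d` that conserves `K_cm` is the
measure-preserving map `collide`, so that (`transOp_eq_avgOp`)
`(𝐀_λ Ψ)(K, k) = S_λ(|k_d|) ∫ Ψ (collide (K, k) σ) dσ`.
Operators of this form are handled as `avgOp`; identities between them and tensor products of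
operators need only be checked on product vectors.

For `Ψ = w ⊗ f` and fixed `k`, `σ`, the function of `K` under the integral is the vector
`S_λ m U w`: the heavy momentum after the collision is the affine function of `K` implemented by
`U_{k,σ,λ}`, the light one is the argument of `f` in `m`, and the determinant factors cancel
(`symbM_mul_opU`), as `det ((I + λσ)/(1 + λ)) > 0` for `λ < 1`. Since the collision preserves
Lebesgue measure for each `σ`, Tonelli's theorem gives both the domain statement
(`ae_inMulDomain`) and the bound `∑ⱼ ∫∫ ‖S_λ mⱼ U w‖² ≤ 4 (∑ⱼ βⱼ) ‖w‖²`.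

By this bound, `w ↦ S_λ m U w` is a bounded operator `A` from `L²(ℝⁿ)` to the square-integrable
functions of the parameters with values in `L²(ℝⁿ)` (`exists_clm_opSMU`). With `A₁` and `A₂` formed
from `σ₁` and `σ₂`, the integral of the forms over a set `F` is `A₁* 1_F G A₂`, and the cutoffs `1_F`
converge strongly to the identity along an exhaustion (`exists_isStrongIntegral`). Integrating first
over the rotations and then over `k`, Fubini's theorem turns the matrix elements of the full integral
into `∑ⱼ βⱼ ⟨𝐀_λ (v ⊗ fⱼ), (G ⊗ I) 𝐀_λ (w ⊗ fⱼ)⟩` (`integral_form`), which is the partial trace by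
Parseval's identity in the second factor (`isPartialTrace_of_inner_eq`).
-/

noncomputable section

namespace PointScattering

/-! ### Rotations and Haar measure -/

section Rotations

variable {n : ℕ}

theorem act_mul (A B : Matrix (Fin n) (Fin n) ℝ) (p : E n) : act (A * B) p = act A (act B p) := by
  simp [act, map_mul]

theorem act_one (p : E n) : act (1 : Matrix (Fin n) (Fin n) ℝ) p = p := by
  simp [act]

theorem continuous_act :
    Continuous fun z : Matrix (Fin n) (Fin n) ℝ × E n => act z.1 z.2 := by
  have h : (fun z : Matrix (Fin n) (Fin n) ℝ × E n => act z.1 z.2) =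
      fun z => WithLp.toLp 2 (z.1.mulVec z.2.ofLp) := by
    ext z : 1
    exact (WithLp.ofLp_injective 2).eq_iff.1 (Matrix.ofLp_toEuclideanCLM z.1 z.2)
  rw [h]
  fun_prop

theorem continuous_rotMat : Continuous (rotMat (n := n)) :=
  (isEmbedding_rotMat n).continuous

theorem rotMat_mul (σ τ : rotations n) : rotMat (σ * τ) = rotMat σ * rotMat τ := rfl

theorem rotMat_one : rotMat (1 : rotations n) = 1 := rfl

theorem norm_act_rotMat (σ : rotations n) (p : E n) : ‖act (rotMat σ) p‖ = ‖p‖ := by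
  have h : (rotMat σ).transpose * rotMat σ = 1 := (Matrix.mem_orthogonalGroup_iff' _ _).1 σ.1.2
  have h2 : ‖act (rotMat σ) p‖ ^ 2 = ‖p‖ ^ 2 := by
    rw [← real_inner_self_eq_norm_sq, ← real_inner_self_eq_norm_sq]
    have h3 : act (rotMat σ).transpose (act (rotMat σ) p) = p := by rw [← act_mul, h, act_one]
    have h4 : act (rotMat σ).transpose = ContinuousLinearMap.adjoint
        (Matrix.toEuclideanCLM (n := Fin n) (𝕜 := ℝ) (rotMat σ)) := by
      rw [← ContinuousLinearMap.star_eq_adjoint, ← map_star, Matrix.star_eq_conjTranspose,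
        Matrix.conjTranspose_eq_transpose_of_trivial]
    rw [h4] at h3
    conv_rhs => rw [← h3]
    rw [h3, ← ContinuousLinearMap.adjoint_inner_left, h3]
  exact (sq_eq_sq₀ (norm_nonneg _) (norm_nonneg _)).1 h2

/-- A rotation as a linear isometry of momentum space. -/
def rotIso (σ : rotations n) : E n ≃ₗᵢ[ℝ] E n where
  toFun p := act (rotMat σ) p
  invFun p := act (rotMat σ⁻¹) p
  left_inv p := by
    beta_reduce
    rw [← act_mul, ← rotMat_mul, inv_mul_cancel, rotMat_one, act_one]
  right_inv p := by
    beta_reduce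
    rw [← act_mul, ← rotMat_mul, mul_inv_cancel, rotMat_one, act_one]
  map_add' p q := map_add _ p q
  map_smul' a p := map_smul _ a p
  norm_map' := norm_act_rotMat σ

theorem rotIso_apply (σ : rotations n) (p : E n) : rotIso σ p = act (rotMat σ) p := rfl

theorem continuous_rotIso : Continuous fun z : rotations n × E n => rotIso z.1 z.2 :=
  continuous_act.comp (f := fun z : rotations n × E n => (rotMat z.1, z.2))
    ((continuous_rotMat.comp continuous_fst).prodMk continuous_snd)

theorem continuous_rotIso_comp {Z : Type} [TopologicalSpace Z] {a : Z → rotations n} {b : Z → E n}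
    (ha : Continuous a) (hb : Continuous b) : Continuous fun z => rotIso (a z) (b z) :=
  continuous_rotIso.comp (f := fun z => (a z, b z)) (ha.prodMk hb)

instance : SecondCountableTopology (rotations n) := by
  have : SecondCountableTopology (Matrix (Fin n) (Fin n) ℝ) :=
    inferInstanceAs (SecondCountableTopology (Fin n → Fin n → ℝ))
  exact (isEmbedding_rotMat n).secondCountableTopology

instance : (haarRot n).IsHaarMeasure := by unfold haarRot; infer_instance

/-- The compact group of rotations is unimodular: a right translate of the normalised Haar measure is
again a Haar probability measure. -/
instance : (haarRot n).IsMulRightInvariant where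
  map_mul_right_eq_self g := by
    have : IsProbabilityMeasure ((haarRot n).map (· * g)) :=
      Measure.isProbabilityMeasure_map (by fun_prop)
    exact Measure.isHaarMeasure_eq_of_isProbabilityMeasure _ _

/-- A linear isometry of momentum space that is orientation preserving, or arbitrary if `n = 1`,
is given by a rotation. -/
theorem exists_rotIso_eq_isometry (R : E n ≃ₗᵢ[ℝ] E n)
    (hR : n = 1 ∨ LinearMap.det R.toLinearEquiv.toLinearMap = 1) :
    ∃ σ : rotations n, ∀ p, rotIso σ p = R p := by
  set A := (Matrix.toEuclideanCLM (n := Fin n) (𝕜 := ℝ)).symm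
    R.toContinuousLinearEquiv.toContinuousLinearMap with hA
  have hA' : Matrix.toEuclideanCLM (n := Fin n) (𝕜 := ℝ) A =
      R.toContinuousLinearEquiv.toContinuousLinearMap := by rw [hA, StarAlgEquiv.apply_symm_apply]
  have hdet : A.det = LinearMap.det R.toLinearEquiv.toLinearMap := by
    have : LinearMap.det (Matrix.toEuclideanCLM (n := Fin n) (𝕜 := ℝ) A).toLinearMap = A.det := by
      change LinearMap.det (Matrix.toLpLin 2 2 A) = A.det
      rw [Matrix.toLpLin_eq_toLin, LinearMap.det_toLin]
    rw [← this, hA']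
    rfl
  have horth : A ∈ Matrix.orthogonalGroup (Fin n) ℝ := by
    rw [Matrix.mem_orthogonalGroup_iff']
    refine (Matrix.toEuclideanCLM (n := Fin n) (𝕜 := ℝ)).injective
      (?_ : Matrix.toEuclideanCLM (n := Fin n) (𝕜 := ℝ) _ =
        Matrix.toEuclideanCLM (n := Fin n) (𝕜 := ℝ) _)
    rw [map_mul, map_one, ← Matrix.conjTranspose_eq_transpose_of_trivial,
      ← Matrix.star_eq_conjTranspose, map_star, hA']
    ext1 p
    refine ext_inner_left ℝ fun q => ?_
    rw [ContinuousLinearMap.star_eq_adjoint]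
    simp only [mul_apply_eq_comp, ContinuousLinearMap.adjoint_inner_right]
    exact R.inner_map_map q p
  refine ⟨⟨⟨A, horth⟩, hR.imp_right fun h => hdet.trans h⟩, fun p => ?_⟩
  rw [rotIso_apply]
  exact DFunLike.congr_fun hA' p

/-- The group of rotations acts transitively on the unit sphere: if the reflection exchanging two
vectors does not belong to it, composing with the reflection along a vector orthogonal to the
second one corrects the determinant. -/
theorem exists_rotIso_eq (x y : E n) (h : ‖x‖ = ‖y‖) : ∃ σ : rotations n, rotIso σ x = y := by
  by_cases hxy : x = y
  · exact ⟨1, by rw [rotIso_apply, rotMat_one, act_one, hxy]⟩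
  have hdet (z : E n) (hz : z ≠ 0) :
      LinearMap.det ((ℝ ∙ z)ᗮ.reflection.toLinearEquiv.toLinearMap) = -1 := by
    have := (ℝ ∙ z)ᗮ.det_reflection (𝕜 := ℝ)
    rw [Submodule.orthogonal_orthogonal, finrank_span_singleton hz, pow_one] at this
    exact this
  set R := (ℝ ∙ (x - y))ᗮ.reflection
  have hRx : R x = y := Submodule.reflection_sub h
  by_cases hn : n = 1
  · obtain ⟨σ, hσ⟩ := exists_rotIso_eq_isometry R (Or.inl hn)
    exact ⟨σ, (hσ x).trans hRx⟩
  have hn0 : n ≠ 0 := by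
    rintro rfl
    exact hxy (Subsingleton.elim _ _)
  obtain ⟨z, hzy, hz⟩ : ∃ z ∈ (ℝ ∙ y)ᗮ, z ≠ 0 := by
    apply Submodule.exists_mem_ne_zero_of_ne_bot
    intro hbot
    have h1 := Submodule.finrank_add_finrank_orthogonal (ℝ ∙ y)
    rw [hbot, finrank_bot, finrank_euclideanSpace_fin] at h1
    have h2 := finrank_span_le_card (R := ℝ) ({y} : Set (E n))
    simp at h2
    omega
  obtain ⟨σ, hσ⟩ := exists_rotIso_eq_isometry (R.trans (ℝ ∙ z)ᗮ.reflection) (Or.inr (by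
    have : (R.trans (ℝ ∙ z)ᗮ.reflection).toLinearEquiv.toLinearMap =
        (ℝ ∙ z)ᗮ.reflection.toLinearEquiv.toLinearMap ∘ₗ R.toLinearEquiv.toLinearMap := rfl
    rw [this, LinearMap.det_comp, hdet z hz, hdet (x - y) (sub_ne_zero.2 hxy)]
    norm_num))
  refine ⟨σ, (hσ x).trans ?_⟩
  rw [LinearIsometryEquiv.trans_apply, hRx]
  apply Submodule.reflection_mem_subspace_eq_self
  rw [Submodule.mem_orthogonal_singleton_iff_inner_right] at hzy ⊢
  rw [real_inner_comm, hzy]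

end Rotations

/-! ### Averages of measure-preserving substitutions -/

/-- Almost every slice of a square-integrable function is square-integrable. -/
theorem ae_memLp_slice {X Y F : Type} [MeasurableSpace X] [MeasurableSpace Y]
    [NormedAddCommGroup F] {μ : Measure X} {ν : Measure Y} [SFinite μ]
    [SFinite ν] {f : X × Y → F}
    (hf : MemLp f 2 (μ.prod ν)) : ∀ᵐ x ∂μ, MemLp (fun y => f (x, y)) 2 ν := by
  have h := ((memLp_two_iff_integrable_sq_norm hf.1).1 hf).prod_right_ae
  filter_upwards [h, hf.1.prodMk_left] with x h1 h2
  exact (memLp_two_iff_integrable_sq_norm h2).2 h1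

theorem eLpNorm_two_sq {X F : Type} [MeasurableSpace X] [NormedAddCommGroup F] (μ : Measure X)
    (f : X → F) : eLpNorm f 2 μ ^ 2 = ∫⁻ x, ‖f x‖ₑ ^ 2 ∂μ := by
  have := eLpNorm_nnreal_pow_eq_lintegral (f := f) (μ := μ) (p := 2) (by norm_num)
  simpa using this

theorem average_congr {X S : Type} [MeasurableSpace X] [MeasurableSpace S] {μ : Measure X}
    {κ : Measure S} [SFinite κ] {f g : X × S → ℂ} (h : f =ᵐ[μ.prod κ] g) :
    (fun x => ∫ s, f (x, s) ∂κ) =ᵐ[μ] fun x => ∫ s, g (x, s) ∂κ := by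
  filter_upwards [Measure.ae_ae_of_ae_prod h] with x hx
  exact integral_congr_ae hx

section Averaging

variable {X S : Type} [MeasurableSpace X] [MeasurableSpace S]
  {μ : Measure X} {κ : Measure S} [SFinite μ] [IsProbabilityMeasure κ]

/-- If every section `θ (·, s)` preserves `μ`, then so does `θ` as a map on the product of `μ` with
a probability measure. -/
theorem measurePreserving_of_sections {θ : X × S → X} (hθ : Measurable θ)
    (h : ∀ s, MeasurePreserving (fun x => θ (x, s)) μ μ) : MeasurePreserving θ (μ.prod κ) μ := by
  have h1 : MeasurePreserving (fun z : S × X => (z.1, θ (z.2, z.1))) (κ.prod μ) (κ.prod μ) :=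
    MeasurePreserving.skew_product (g := fun s x => θ (x, s)) (MeasurePreserving.id _)
      (hθ.comp measurable_swap) (Eventually.of_forall fun s => (h s).map_eq)
  exact (measurePreserving_snd.comp h1).comp Measure.measurePreserving_swap

/-- Averaging over the second variable is a contraction of `L²`. -/
theorem memLp_average {f : X × S → ℂ} (hf : MemLp f 2 (μ.prod κ)) :
    MemLp (fun x => ∫ s, f (x, s) ∂κ) 2 μ ∧
      eLpNorm (fun x => ∫ s, f (x, s) ∂κ) 2 μ ≤ eLpNorm f 2 (μ.prod κ) := by
  have hle : eLpNorm (fun x => ∫ s, f (x, s) ∂κ) 2 μ ≤ eLpNorm f 2 (μ.prod κ) := by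
    rw [← ENNReal.pow_le_pow_left_iff two_ne_zero, eLpNorm_two_sq, eLpNorm_two_sq,
      lintegral_prod _ (hf.1.enorm.pow_const 2)]
    apply lintegral_mono_ae
    filter_upwards [ae_memLp_slice hf] with x hx
    rw [← eLpNorm_two_sq]
    refine pow_le_pow_left' ((enorm_integral_le_lintegral_enorm _).trans ?_) 2
    rw [← eLpNorm_one_eq_lintegral_enorm]
    exact eLpNorm_le_eLpNorm_of_exponent_le (by norm_num) hx.1
  exact ⟨⟨hf.1.integral_prod_right', hle.trans_lt hf.2⟩, hle⟩

/-- The contraction `L²(μ × κ) → L²(μ)` averaging over the second variable. -/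
def averageCLM (μ : Measure X) (κ : Measure S) [SFinite μ] [IsProbabilityMeasure κ] :
    L2 (μ.prod κ) →L[ℂ] L2 μ :=
  LinearMap.mkContinuous
    { toFun := fun f => (memLp_average (Lp.memLp f)).1.toLp _
      map_add' := fun f g => by
        rw [← MemLp.toLp_add]
        apply MemLp.toLp_congr
        filter_upwards [average_congr (Lp.coeFn_add f g), ae_memLp_slice (Lp.memLp f),
          ae_memLp_slice (Lp.memLp g)] with x h1 h2 h3
        rw [h1]
        exact integral_add (h2.integrable (by norm_num)) (h3.integrable (by norm_num))
      map_smul' := fun c f => by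
        rw [RingHom.id_apply, ← MemLp.toLp_const_smul]
        apply MemLp.toLp_congr
        filter_upwards [average_congr (Lp.coeFn_smul c f)] with x h1
        rw [h1]
        exact integral_const_mul c _ } 1 (fun f => by
    rw [one_mul]
    simp only [LinearMap.coe_mk, AddHom.coe_mk, Lp.norm_toLp]
    exact ENNReal.toReal_mono (Lp.memLp f).2.ne (memLp_average (κ := κ) (Lp.memLp f)).2)

theorem coeFn_averageCLM (f : L2 (μ.prod κ)) :
    averageCLM μ κ f =ᵐ[μ] fun x => ∫ s, f (x, s) ∂κ :=
  (memLp_average (Lp.memLp f)).1.coeFn_toLp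

/-- The operator `(Z g)(x) = m(x) ∫ g (θ (x, s)) dκ(s)`, for a bounded function `m` and a
measure-preserving map `θ`. -/
def avgOp (κ : Measure S) [IsProbabilityMeasure κ] (m : X → ℂ) (hm : MemLp m ∞ μ) (θ : X × S → X)
    (hθ : MeasurePreserving θ (μ.prod κ) μ) : L2 μ →L[ℂ] L2 μ :=
  (ContinuousLinearMap.mul ℂ ℂ).holderL μ ∞ 2 2 (hm.toLp m) ∘L averageCLM μ κ ∘L
    (Lp.compMeasurePreservingₗᵢ ℂ θ hθ).toContinuousLinearMap

theorem coeFn_avgOp {m : X → ℂ} (hm : MemLp m ∞ μ) {θ : X × S → X}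
    (hθ : MeasurePreserving θ (μ.prod κ) μ) (g : L2 μ) :
    avgOp κ m hm θ hθ g =ᵐ[μ] fun x => m x * ∫ s, g (θ (x, s)) ∂κ := by
  have h1 := coeFn_averageCLM (Lp.compMeasurePreservingₗᵢ ℂ θ hθ g)
  have h2 := average_congr (Lp.coeFn_compMeasurePreserving g hθ)
  have h3 := (ContinuousLinearMap.mul ℂ ℂ).coeFn_holder (r := 2) (hm.toLp m)
    (averageCLM μ κ (Lp.compMeasurePreservingₗᵢ ℂ θ hθ g))
  filter_upwards [h1, h2, h3, hm.coeFn_toLp] with x h1 h2 h3 h4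
  refine h3.trans ?_
  rw [h4, h1]
  exact congrArg (m x * ·) h2

/-- The value of an averaging operator, computed with any representative of the vector. -/
theorem coeFn_avgOp_of_ae {m : X → ℂ} (hm : MemLp m ∞ μ) {θ : X × S → X}
    (hθ : MeasurePreserving θ (μ.prod κ) μ) {g : L2 μ} {g' : X → ℂ} (h : g =ᵐ[μ] g') :
    avgOp κ m hm θ hθ g =ᵐ[μ] fun x => m x * ∫ s, g' (θ (x, s)) ∂κ := by
  filter_upwards [coeFn_avgOp hm hθ g,
    average_congr (hθ.quasiMeasurePreserving.ae_eq_comp h)] with x h1 h2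
  rw [h1]
  exact congrArg (m x * ·) h2

end Averaging

/-! ### Operators on tensor products -/

section TensorDense

variable {X Y : Type} [MeasurableSpace X] [MeasurableSpace Y]
  {μ : Measure X} {ν : Measure Y} [SigmaFinite μ] [SigmaFinite ν]

/-- Continuous linear maps on `L²(μ × ν)` that agree on product vectors are equal. -/
theorem ext_tmul {V : Type} [NormedAddCommGroup V] [NormedSpace ℂ V]
    {T T' : L2 (μ.prod ν) →L[ℂ] V}
    (h : ∀ v f, T (tmul μ ν v f) = T' (tmul μ ν v f)) : T = T' := by
  have h1 : (T.toLinearMap ∘ₗ (tensorEmb μ ν).toLinearMap) =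
      T'.toLinearMap ∘ₗ (tensorEmb μ ν).toLinearMap := by
    apply TensorProduct.ext'
    intro v f
    simpa using h v f
  apply DFunLike.coe_injective
  exact (denseRange_tensorEmb μ ν).equalizer T.continuous T'.continuous
    (funext fun z => LinearMap.congr_fun h1 z)

theorem norm_tmul (v : L2 μ) (f : L2 ν) : ‖tmul μ ν v f‖ = ‖v‖ * ‖f‖ := by
  rw [← tensorEmb_tmul, LinearIsometry.norm_map]
  have h := inner_tmul_tmul μ ν v v f f
  rw [← tensorEmb_tmul, LinearIsometry.inner_map_map, inner_self_eq_norm_sq_to_K,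
    inner_self_eq_norm_sq_to_K, inner_self_eq_norm_sq_to_K] at h
  have h' : ‖v ⊗ₜ[ℂ] f‖ ^ 2 = (‖v‖ * ‖f‖) ^ 2 := by
    rw [mul_pow]
    exact_mod_cast h
  exact (sq_eq_sq₀ (norm_nonneg _) (by positivity)).1 h'

theorem inner_tmul_tensorOp (G : L2 μ →L[ℂ] L2 μ) (R : L2 ν →L[ℂ] L2 ν) (v : L2 μ) (f : L2 ν)
    (Ψ : L2 (μ.prod ν)) :
    ⟪tmul μ ν v f, tensorOp μ ν G R Ψ⟫_ℂ =
      ⟪tmul μ ν (ContinuousLinearMap.adjoint G v) (ContinuousLinearMap.adjoint R f), Ψ⟫_ℂ := by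
  have : innerSL ℂ (tmul μ ν v f) ∘L tensorOp μ ν G R =
      innerSL ℂ (tmul μ ν (ContinuousLinearMap.adjoint G v) (ContinuousLinearMap.adjoint R f)) := by
    apply ext_tmul
    intro v' f'
    simp [tensorOp_tmul, inner_tmul_tmul, ContinuousLinearMap.adjoint_inner_left]
  exact DFunLike.congr_fun this Ψ

end TensorDense

/-! ### The transition operator as an average over rotations -/

section Conjugation

variable {X Y S : Type} [MeasurableSpace X] [MeasurableSpace Y] [MeasurableSpace S]
  {μ : Measure X} {ν : Measure Y} {κ : Measure S} [IsProbabilityMeasure κ]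

theorem adjoint_comp_self_compMeasurePreserving {π : Y → X} (hπ : MeasurePreserving π ν μ) :
    ContinuousLinearMap.adjoint
      (Lp.compMeasurePreservingₗᵢ ℂ π hπ : L2 μ →ₗᵢ[ℂ] L2 ν).toContinuousLinearMap ∘L
      (Lp.compMeasurePreservingₗᵢ ℂ π hπ : L2 μ →ₗᵢ[ℂ] L2 ν).toContinuousLinearMap = 1 :=
  (ContinuousLinearMap.norm_map_iff_adjoint_comp_self _).1 fun g =>
    (Lp.compMeasurePreservingₗᵢ ℂ π hπ : L2 μ →ₗᵢ[ℂ] L2 ν).norm_map g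

/-- An averaging operator in the coordinates given by a measure-preserving map `π`. -/
theorem adjoint_comp_avgOp_comp [SFinite μ] [SFinite ν] {π : Y → X} (hπ : MeasurePreserving π ν μ)
    {m : X → ℂ} (hm : MemLp m ∞ μ) {θ : X × S → X} (hθ : MeasurePreserving θ (μ.prod κ) μ)
    {m' : Y → ℂ} (hm' : MemLp m' ∞ ν) {θ' : Y × S → Y} (hθ' : MeasurePreserving θ' (ν.prod κ) ν)
    (hmm : ∀ y, m' y = m (π y)) (hθθ : ∀ y s, π (θ' (y, s)) = θ (π y, s)) :
    ContinuousLinearMap.adjoint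
      (Lp.compMeasurePreservingₗᵢ ℂ π hπ : L2 μ →ₗᵢ[ℂ] L2 ν).toContinuousLinearMap ∘L
      avgOp κ m' hm' θ' hθ' ∘L
      (Lp.compMeasurePreservingₗᵢ ℂ π hπ : L2 μ →ₗᵢ[ℂ] L2 ν).toContinuousLinearMap =
    avgOp κ m hm θ hθ := by
  -- composition with `π` intertwines the two averages, and it is an isometry
  have key : avgOp κ m' hm' θ' hθ' ∘L
      (Lp.compMeasurePreservingₗᵢ ℂ π hπ : L2 μ →ₗᵢ[ℂ] L2 ν).toContinuousLinearMap =
      (Lp.compMeasurePreservingₗᵢ ℂ π hπ : L2 μ →ₗᵢ[ℂ] L2 ν).toContinuousLinearMap ∘L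
        avgOp κ m hm θ hθ := by
    ext1 g
    apply Lp.ext
    have h1 := coeFn_avgOp_of_ae hm' hθ' (Lp.coeFn_compMeasurePreserving g hπ)
    have h2 := Lp.coeFn_compMeasurePreserving (avgOp κ m hm θ hθ g) hπ
    have h3 := hπ.quasiMeasurePreserving.ae_eq_comp (coeFn_avgOp hm hθ g)
    refine h1.trans (EventuallyEq.trans ?_ (h2.trans h3).symm)
    refine Eventually.of_forall fun y => ?_
    simp only [Function.comp_apply, hmm, hθθ]
  rw [key, ← ContinuousLinearMap.comp_assoc, adjoint_comp_self_compMeasurePreserving]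
  exact ContinuousLinearMap.id_comp _

end Conjugation

section Sphere

variable {n : ℕ}

/-- The action of a rotation on the unit sphere. -/
def rotSphere (σ : rotations n) (ω : Metric.sphere (0 : E n) 1) : Metric.sphere (0 : E n) 1 :=
  ⟨rotIso σ ω, by simp⟩

theorem coe_rotSphere (σ : rotations n) (ω : Metric.sphere (0 : E n) 1) :
    (rotSphere σ ω : E n) = rotIso σ ω := rfl

theorem rotSphere_mul (σ τ : rotations n) (ω : Metric.sphere (0 : E n) 1) :
    rotSphere (σ * τ) ω = rotSphere σ (rotSphere τ ω) := by
  ext1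
  simp only [coe_rotSphere, rotIso_apply, rotMat_mul, act_mul]

theorem continuous_rotSphere :
    Continuous fun z : Metric.sphere (0 : E n) 1 × rotations n => rotSphere z.2 z.1 :=
  Continuous.subtype_mk
    (continuous_rotIso_comp continuous_snd (continuous_subtype_val.comp continuous_fst)) _

theorem continuous_rotSphere_left (σ : rotations n) : Continuous (rotSphere σ) :=
  continuous_rotSphere.comp (f := fun ω => (ω, σ)) (continuous_id.prodMk continuous_const)

open scoped Pointwise in
theorem measurePreserving_rotSphere (σ : rotations n) :
    MeasurePreserving (rotSphere σ) (surfaceMeasure n) (surfaceMeasure n) := by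
  have hc := continuous_rotSphere_left σ
  refine ⟨hc.measurable, ?_⟩
  ext s hs
  rw [Measure.map_apply hc.measurable hs, Measure.toSphere_apply' _ hs,
    Measure.toSphere_apply' _ (hc.measurable hs)]
  congr 1
  have hset : Set.Ioo (0 : ℝ) 1 • ((↑) '' (rotSphere σ ⁻¹' s) : Set (E n)) =
      (rotIso σ) ⁻¹' (Set.Ioo (0 : ℝ) 1 • ((↑) '' s : Set (E n))) := by
    ext p
    simp only [Set.mem_smul, Set.mem_preimage]
    constructor
    · rintro ⟨r, hr, _, ⟨ω, hω, rfl⟩, rfl⟩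
      exact ⟨r, hr, _, ⟨rotSphere σ ω, hω, rfl⟩, by rw [map_smul, coe_rotSphere]⟩
    · rintro ⟨r, hr, _, ⟨ω, hω, rfl⟩, hp⟩
      refine ⟨r, hr, _, ⟨rotSphere σ⁻¹ ω, ?_, rfl⟩, ?_⟩
      · rw [Set.mem_preimage, ← rotSphere_mul, mul_inv_cancel]
        convert hω
        ext1
        rw [coe_rotSphere, rotIso_apply, rotMat_one, act_one]
      · apply (rotIso σ).injective
        rw [map_smul, ← hp, ← coe_rotSphere, ← rotSphere_mul, mul_inv_cancel, coe_rotSphere,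
          rotIso_apply, rotMat_one, act_one]
  rw [hset]
  exact (rotIso σ).measurePreserving.measure_preimage_emb
    (rotIso σ).toHomeomorph.measurableEmbedding _

theorem measurePreserving_rotSphere_prod (n : ℕ) :
    MeasurePreserving (fun z : Metric.sphere (0 : E n) 1 × rotations n => rotSphere z.2 z.1)
      ((surfaceMeasure n).prod (haarRot n)) (surfaceMeasure n) :=
  measurePreserving_of_sections continuous_rotSphere.measurable measurePreserving_rotSphere

/-- Averaging over the orbit of any point of the sphere is averaging over the sphere. -/
theorem integral_rotSphere [NeZero n] (a : Metric.sphere (0 : E n) 1 → ℂ)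
    (ha : Integrable a (surfaceMeasure n)) (ω : Metric.sphere (0 : E n) 1) :
    ∫ σ, a (rotSphere σ ω) ∂(haarRot n) =
      (((surfaceMeasure n).real Set.univ)⁻¹ : ℝ) * ∫ ω', a ω' ∂(surfaceMeasure n) := by
  have hconst : ∀ ω', ∫ σ, a (rotSphere σ ω') ∂(haarRot n) =
      ∫ σ, a (rotSphere σ ω) ∂(haarRot n) := by
    -- two points of the sphere differ by a rotation `τ`, and `σ ↦ σ τ` preserves Haar measure
    intro ω'
    obtain ⟨τ, hτ⟩ := exists_rotIso_eq (ω : E n) ω' (by simp)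
    have hτ' : rotSphere τ ω = ω' := Subtype.ext hτ
    rw [← integral_mul_right_eq_self (fun σ => a (rotSphere σ ω)) τ]
    simp only [rotSphere_mul, hτ']
  have hθ := measurePreserving_rotSphere_prod n
  have h1 : ∫ z, a (rotSphere z.2 z.1) ∂((surfaceMeasure n).prod (haarRot n)) =
      ∫ ω', a ω' ∂(surfaceMeasure n) := by
    conv_rhs => rw [← hθ.map_eq]
    exact (integral_map hθ.aemeasurable (by rw [hθ.map_eq]; exact ha.1)).symm
  rw [integral_prod (fun z => a (rotSphere z.2 z.1)) (hθ.integrable_comp_of_integrable ha)] at h1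
  simp only [hconst, integral_const] at h1
  rw [← h1, Complex.real_smul, ← mul_assoc, ← Complex.ofReal_mul, inv_mul_cancel₀, Complex.ofReal_one,
    one_mul]
  have : Nontrivial (E n) := by
    have : Nonempty (Fin n) := ⟨0⟩
    infer_instance
  rw [Measure.real, ENNReal.toReal_ne_zero]
  exact ⟨Measure.measure_univ_ne_zero.2 (leb n).toSphere_ne_zero, measure_ne_top _ _⟩

theorem memLp_scatCoeff_polar (n : ℕ) (c lam : ℝ) :
    MemLp (fun z : Metric.sphere (0 : E n) 1 × Set.Ioi (0 : ℝ) => scatCoeff n c lam z.2) ∞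
      ((surfaceMeasure n).prod (radialMeasure n)) :=
  memLp_top_of_bound ((measurable_scatCoeff n c lam).comp
    (by fun_prop : Measurable fun z : Metric.sphere (0 : E n) 1 × Set.Ioi (0 : ℝ) =>
      (z.2 : ℝ))).aestronglyMeasurable 2
    (Eventually.of_forall fun _ => norm_scatCoeff_le _ _ _ _)

theorem memLp_scatCoeff_norm (n : ℕ) (c lam : ℝ) :
    MemLp (fun p : E n => scatCoeff n c lam ‖p‖) ∞ (leb n) :=
  memLp_top_of_bound ((measurable_scatCoeff n c lam).comp
    (by fun_prop : Measurable fun p : E n => ‖p‖)).aestronglyMeasurable 2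
    (Eventually.of_forall fun _ => norm_scatCoeff_le _ _ _ _)

theorem memLp_scatCoeff_norm_snd (n : ℕ) (c lam : ℝ) :
    MemLp (fun z : E n × E n => scatCoeff n c lam ‖z.2‖) ∞ ((leb n).prod (leb n)) :=
  memLp_top_of_bound ((measurable_scatCoeff n c lam).comp
    (by fun_prop : Measurable fun z : E n × E n => ‖z.2‖)).aestronglyMeasurable 2
    (Eventually.of_forall fun _ => norm_scatCoeff_le _ _ _ _)

theorem measurePreserving_rotPolar (n : ℕ) :
    MeasurePreserving
      (fun z : (Metric.sphere (0 : E n) 1 × Set.Ioi (0 : ℝ)) × rotations n =>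
        (rotSphere z.2 z.1.1, z.1.2))
      (((surfaceMeasure n).prod (radialMeasure n)).prod (haarRot n))
      ((surfaceMeasure n).prod (radialMeasure n)) := by
  apply measurePreserving_of_sections
  · exact (continuous_rotSphere.measurable.comp
      (f := fun z : (Metric.sphere (0 : E n) 1 × Set.Ioi (0 : ℝ)) × rotations n => (z.1.1, z.2))
      (by fun_prop)).prodMk (by fun_prop)
  · intro σ
    exact (measurePreserving_rotSphere σ).prod (MeasurePreserving.id _)

/-- In polar coordinates, the projection onto constant functions of the angle is the average over
rotations. -/
theorem tensorOp_rankOne_radialScat (n : ℕ) [NeZero n] (c lam : ℝ) :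
    tensorOp (surfaceMeasure n) (radialMeasure n)
      (InnerProductSpace.rankOne ℂ (sphereConst n) (sphereConst n)) (radialScat n c lam) =
    avgOp (haarRot n)
      (fun z : Metric.sphere (0 : E n) 1 × Set.Ioi (0 : ℝ) => scatCoeff n c lam z.2)
      (memLp_scatCoeff_polar n c lam) _
      (measurePreserving_rotPolar n) := by
  apply ext_tmul
  intro a b
  rw [tensorOp_tmul, InnerProductSpace.rankOne_apply]
  set s := (surfaceMeasure n).real Set.univ with hs
  have hφ : (sphereConst n : Metric.sphere (0 : E n) 1 → ℂ) =ᵐ[surfaceMeasure n]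
      fun _ => (((Real.sqrt s)⁻¹ : ℝ) : ℂ) := Lp.coeFn_const _ _ _
  have hinner : ⟪sphereConst n, a⟫_ℂ = (((Real.sqrt s)⁻¹ : ℝ) : ℂ) * ∫ ω, a ω ∂(surfaceMeasure n) := by
    rw [L2.inner_def, ← integral_const_mul]
    apply integral_congr_ae
    filter_upwards [hφ] with ω h
    rw [h, RCLike.inner_apply, Complex.conj_ofReal, mul_comm]
  have ha : Integrable a (surfaceMeasure n) := (Lp.memLp a).integrable (by norm_num)
  apply Lp.ext
  have h1 : (fun z : Metric.sphere (0 : E n) 1 × Set.Ioi (0 : ℝ) =>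
      (⟪sphereConst n, a⟫_ℂ • sphereConst n : L2 (surfaceMeasure n)) z.1)
      =ᵐ[(surfaceMeasure n).prod (radialMeasure n)]
      fun _ => ⟪sphereConst n, a⟫_ℂ * (((Real.sqrt s)⁻¹ : ℝ) : ℂ) := by
    refine (Measure.quasiMeasurePreserving_fst (μ := surfaceMeasure n)
      (ν := radialMeasure n)).ae_eq_comp (g := fun ω =>
        (⟪sphereConst n, a⟫_ℂ • sphereConst n : L2 (surfaceMeasure n)) ω)
      (g' := fun _ => ⟪sphereConst n, a⟫_ℂ * (((Real.sqrt s)⁻¹ : ℝ) : ℂ)) ?_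
    filter_upwards [Lp.coeFn_smul ⟪sphereConst n, a⟫_ℂ (sphereConst n), hφ] with ω e1 e2
    rw [e1, Pi.smul_apply, e2, smul_eq_mul]
  have h2 : (fun z : Metric.sphere (0 : E n) 1 × Set.Ioi (0 : ℝ) => radialScat n c lam b z.2)
      =ᵐ[(surfaceMeasure n).prod (radialMeasure n)] fun z => scatCoeff n c lam z.2 * b z.2 := by
    refine (Measure.quasiMeasurePreserving_snd (μ := surfaceMeasure n)
      (ν := radialMeasure n)).ae_eq_comp (g := fun r => radialScat n c lam b r)
      (g' := fun r => scatCoeff n c lam r * b r) ?_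
    filter_upwards [(memLp_scatCoeff n c lam).coeFn_toLp,
      (ContinuousLinearMap.mul ℂ ℂ).coeFn_holder (r := 2) ((memLp_scatCoeff n c lam).toLp _) b]
      with r e1 e2
    exact e2.trans (by rw [e1]; rfl)
  filter_upwards [coeFn_tmul (surfaceMeasure n) (radialMeasure n)
    (⟪sphereConst n, a⟫_ℂ • sphereConst n) (radialScat n c lam b), h1, h2,
    coeFn_avgOp_of_ae (memLp_scatCoeff_polar n c lam)
      (measurePreserving_rotPolar n) (coeFn_tmul (surfaceMeasure n) (radialMeasure n) a b)]
    with z h3 h4 h5 h6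
  rw [h3, h6]
  rw [h4, h5, integral_mul_const, integral_rotSphere a ha, hinner]
  have hsq : (((Real.sqrt s)⁻¹ : ℝ) : ℂ) * (((Real.sqrt s)⁻¹ : ℝ) : ℂ) = ((s⁻¹ : ℝ) : ℂ) := by
    rw [← Complex.ofReal_mul, ← mul_inv, Real.mul_self_sqrt measureReal_nonneg]
  rw [← hs, ← hsq]
  ring

theorem measurePreserving_rotIso_prod (n : ℕ) :
    MeasurePreserving (fun z : E n × rotations n => rotIso z.2 z.1)
      ((leb n).prod (haarRot n)) (leb n) :=
  measurePreserving_of_sections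
    (continuous_rotIso_comp continuous_snd continuous_fst).measurable
    fun σ => (rotIso σ).measurePreserving

/-- The operator `S_λ(r) ⊗ |φ⟩⟨φ|` averages over rotations and multiplies by `S_λ(|p|)`. -/
theorem sWave_eq_avgOp (n : ℕ) [NeZero n] (c lam : ℝ) :
    sWave n c lam = avgOp (haarRot n) (fun p : E n => scatCoeff n c lam ‖p‖)
      (memLp_scatCoeff_norm n c lam) _ (measurePreserving_rotIso_prod n) := by
  rw [sWave, tensorOp_rankOne_radialScat]
  apply adjoint_comp_avgOp_comp
  · intro z
    rw [norm_smul, norm_eq_of_mem_sphere, mul_one, Real.norm_of_nonneg z.2.2.le]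
  · intro z σ
    rw [map_smul, coe_rotSphere]

end Sphere

section Collision

variable {n : ℕ}

/-- The change of the momenta `(K, k)` of the heavy and the light particle when `k_d` is rotated
and `K_cm` is conserved. -/
def collide (lam : ℝ) (z : (E n × E n) × rotations n) : E n × E n :=
  (z.1.1 - (1 + lam)⁻¹ • act (rotMat z.2 - 1) (z.1.2 - lam • z.1.1),
    z.1.2 + (1 + lam)⁻¹ • act (rotMat z.2 - 1) (z.1.2 - lam • z.1.1))

theorem act_sub_one (A : Matrix (Fin n) (Fin n) ℝ) (p : E n) : act (A - 1) p = act A p - p := by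
  simp [act]

/-- In the coordinates `(K_cm, k_d)`, a collision rotates `k_d` and leaves `K_cm` fixed. -/
theorem fromCM_rotIso {lam : ℝ} (h : 1 + lam ≠ 0) (z : E n × E n) (σ : rotations n) :
    fromCM n lam (z.1, rotIso σ z.2) = collide lam (fromCM n lam z, σ) := by
  have hd : (1 + lam)⁻¹ • ((fromCM n lam z).2 - lam • (fromCM n lam z).1) = z.2 := by
    simp only [fromCM]
    ext i
    simp
    field_simp
    ring
  rw [collide]
  simp only
  have hδ : (1 + lam)⁻¹ • act (rotMat σ - 1) ((fromCM n lam z).2 - lam • (fromCM n lam z).1) =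
      rotIso σ z.2 - z.2 := by
    rw [← map_smul, hd, rotIso_apply]
    exact act_sub_one _ _
  rw [hδ]
  simp only [fromCM]
  ext i
  · simp
  · simp
    ring

theorem continuous_collide (lam : ℝ) : Continuous (collide (n := n) lam) := by
  have : Continuous fun z : (E n × E n) × rotations n =>
      act (rotMat z.2 - 1) (z.1.2 - lam • z.1.1) :=
    continuous_act.comp (f := fun z : (E n × E n) × rotations n =>
      (rotMat z.2 - 1, z.1.2 - lam • z.1.1))
      (((continuous_rotMat.comp continuous_snd).sub continuous_const).prodMk (by fun_prop))
  unfold collide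
  fun_prop

theorem measurePreserving_collide {lam : ℝ} (h : 1 + lam ≠ 0) (σ : rotations n) :
    MeasurePreserving (fun z => collide lam (z, σ)) ((leb n).prod (leb n))
      ((leb n).prod (leb n)) := by
  have hm : Measurable fun z => collide lam (z, σ) :=
    ((continuous_collide lam).comp (by fun_prop)).measurable
  refine ⟨hm, ?_⟩
  have h1 := measurePreserving_fromCM n lam h
  have h2 : MeasurePreserving (fun z : E n × E n => (z.1, rotIso σ z.2)) ((leb n).prod (leb n))
      ((leb n).prod (leb n)) := (MeasurePreserving.id _).prod (rotIso σ).measurePreserving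
  conv_lhs => rw [← h1.map_eq]
  rw [Measure.map_map hm h1.measurable]
  have := (h1.comp h2).map_eq
  convert this using 2
  ext1 z
  exact (fromCM_rotIso h z σ).symm

theorem measurePreserving_collide_prod {lam : ℝ} (h : 1 + lam ≠ 0) :
    MeasurePreserving (collide (n := n) lam) (((leb n).prod (leb n)).prod (haarRot n))
      ((leb n).prod (leb n)) :=
  measurePreserving_of_sections (continuous_collide lam).measurable (measurePreserving_collide h)

theorem measurable_symbS (n : ℕ) (c lam : ℝ) :
    Measurable fun z : E n × E n => symbS n c lam z.2 z.1 :=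
  (measurable_scatCoeff n c lam).comp (by fun_prop)

theorem memLp_symbS (n : ℕ) (c lam : ℝ) :
    MemLp (fun z : E n × E n => symbS n c lam z.2 z.1) ∞ ((leb n).prod (leb n)) :=
  memLp_top_of_bound (measurable_symbS n c lam).aestronglyMeasurable 2
    (Eventually.of_forall fun _ => norm_scatCoeff_le _ _ _ _)

/-- With the centre-of-mass momentum as an inert variable, `S_λ(r) ⊗ |φ⟩⟨φ|` remains an average over
rotations. -/
theorem tensorOp_sWave (n : ℕ) [NeZero n] (c lam : ℝ)
    (hθ : MeasurePreserving (fun z : (E n × E n) × rotations n => (z.1.1, rotIso z.2 z.1.2))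
      (((leb n).prod (leb n)).prod (haarRot n)) ((leb n).prod (leb n))) :
    tensorOp (leb n) (leb n) 1 (sWave n c lam) =
      avgOp (haarRot n) (fun z : E n × E n => scatCoeff n c lam ‖z.2‖)
        (memLp_scatCoeff_norm_snd n c lam) _ hθ := by
  apply ext_tmul
  intro v f
  rw [tensorOp_tmul, one_apply_eq_self, sWave_eq_avgOp]
  apply Lp.ext
  filter_upwards [coeFn_tmul (leb n) (leb n) v (avgOp (haarRot n) _
      (memLp_scatCoeff_norm n c lam) _ (measurePreserving_rotIso_prod n) f),
    (Measure.quasiMeasurePreserving_snd (μ := leb n) (ν := leb n)).ae_eq_comp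
      (coeFn_avgOp (memLp_scatCoeff_norm n c lam) (measurePreserving_rotIso_prod n) f),
    coeFn_avgOp_of_ae (memLp_scatCoeff_norm_snd n c lam) hθ
      (coeFn_tmul (leb n) (leb n) v f)] with z h1 h2 h3
  rw [h1, h3]
  simp only [Function.comp_apply] at h2
  rw [h2, integral_const_mul]
  ring

/-- The operator `𝐀_λ` averages over the collisions with a given rotation of `k_d`. -/
theorem transOp_eq_avgOp (n : ℕ) [NeZero n] (c lam : ℝ) (h : 0 ≤ lam) :
    transOp n c lam h = avgOp (haarRot n) (fun z : E n × E n => symbS n c lam z.2 z.1)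
      (memLp_symbS n c lam) (collide lam)
      (measurePreserving_collide_prod (by positivity)) := by
  have hθ : MeasurePreserving (fun z : (E n × E n) × rotations n => (z.1.1, rotIso z.2 z.1.2))
      (((leb n).prod (leb n)).prod (haarRot n)) ((leb n).prod (leb n)) :=
    measurePreserving_of_sections (Continuous.measurable
      ((continuous_fst.comp continuous_fst).prodMk
        (continuous_rotIso_comp continuous_snd (continuous_snd.comp continuous_fst))))
      fun σ => (MeasurePreserving.id _).prod (rotIso σ).measurePreserving
  have h0 : (1 + lam) ≠ 0 := by positivity
  have hW : ContinuousLinearMap.adjoint (toCM n lam h) ∘L toCM n lam h = 1 :=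
    adjoint_comp_self_compMeasurePreserving _
  rw [transOp, scatOp, ContinuousLinearMap.add_comp, ContinuousLinearMap.comp_add]
  have : (1 : H₂ n →L[ℂ] H₂ n) ∘L toCM n lam h = toCM n lam h := ContinuousLinearMap.id_comp _
  rw [this, hW, add_sub_cancel_left, tensorOp_sWave n c lam hθ]
  apply adjoint_comp_avgOp_comp
  · intro z
    rw [symbS]
    congr 2
    ext i
    simp [fromCM]
    field_simp
    ring
  · exact fromCM_rotIso h0

end Collision

/-! ### Slices of square-integrable functions as vector-valued functions -/

section Slices

variable {n : ℕ}

/-- This makes the separability of `L²` available to instance search. -/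
instance : Fact ((2 : ℝ≥0∞) ≠ ∞) := ⟨by norm_num⟩

theorem coeFn_toL2 {g : E n → ℂ} (hg : MemLp g 2 (leb n)) : toL2 g =ᵐ[leb n] g := by
  rw [toL2, dif_pos hg]
  exact hg.coeFn_toLp

theorem toL2_congr {g g' : E n → ℂ} (h : g =ᵐ[leb n] g') : toL2 g = toL2 g' := by
  by_cases hg : MemLp g 2 (leb n)
  · apply Lp.ext
    exact (coeFn_toL2 hg).trans (h.trans (coeFn_toL2 ((memLp_congr_ae h).1 hg)).symm)
  · rw [toL2, toL2, dif_neg hg, dif_neg (mt (memLp_congr_ae h).2 hg)]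

theorem toL2_eq_of_ae {g : E n → ℂ} {u : H n} (h : u =ᵐ[leb n] g) : toL2 g = u :=
  Lp.ext ((coeFn_toL2 ((memLp_congr_ae h).1 (Lp.memLp u))).trans h.symm)

theorem toL2_add {g g' : E n → ℂ} (hg : MemLp g 2 (leb n)) (hg' : MemLp g' 2 (leb n)) :
    toL2 (fun p => g p + g' p) = toL2 g + toL2 g' := by
  apply toL2_eq_of_ae
  filter_upwards [Lp.coeFn_add (toL2 g) (toL2 g'), coeFn_toL2 hg, coeFn_toL2 hg'] with p h1 h2 h3
  rw [h1, Pi.add_apply, h2, h3]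

theorem toL2_const_mul {g : E n → ℂ} (c : ℂ) (hg : MemLp g 2 (leb n)) :
    toL2 (fun p => c * g p) = c • toL2 g := by
  apply toL2_eq_of_ae
  filter_upwards [Lp.coeFn_smul c (toL2 g), coeFn_toL2 hg] with p h1 h2
  rw [h1, Pi.smul_apply, h2, smul_eq_mul]

theorem enorm_toL2_sub {g : E n → ℂ} (hg : MemLp g 2 (leb n)) (u : H n) :
    ‖toL2 g - u‖ₑ ^ 2 = ∫⁻ p, ‖g p - u p‖ₑ ^ 2 ∂(leb n) := by
  rw [← eLpNorm_two_sq, Lp.enorm_def]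
  congr 1
  apply eLpNorm_congr_ae
  filter_upwards [Lp.coeFn_sub (toL2 g) u, coeFn_toL2 hg] with p h1 h2
  rw [h1, Pi.sub_apply, h2]

theorem enorm_toL2 {g : E n → ℂ} (hg : MemLp g 2 (leb n)) :
    ‖toL2 g‖ₑ ^ 2 = ∫⁻ p, ‖g p‖ₑ ^ 2 ∂(leb n) := by
  rw [← eLpNorm_two_sq, Lp.enorm_def]
  congr 1
  exact eLpNorm_congr_ae (coeFn_toL2 hg)

theorem memLp_two_iff_lintegral {X F : Type} [MeasurableSpace X] [NormedAddCommGroup F]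
    {μ : Measure X} {f : X → F} (hf : AEStronglyMeasurable f μ) :
    MemLp f 2 μ ↔ ∫⁻ x, ‖f x‖ₑ ^ 2 ∂μ < ∞ := by
  rw [← eLpNorm_two_sq, ENNReal.pow_lt_top_iff]
  simp [MemLp, hf]

variable {X : Type} [MeasurableSpace X]

/-- The slices of a jointly measurable function depend measurably on the parameter: the balls
generate the Borel sets of `L²`, and distances between slices and fixed vectors are integrals. -/
theorem stronglyMeasurable_toL2 {F : X → E n → ℂ} (hF : Measurable (Function.uncurry F)) :
    StronglyMeasurable fun x => toL2 (F x) := by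
  borelize (H n)
  suffices h : Measurable fun x => toL2 (F x) from h.stronglyMeasurable
  have hbasis : TopologicalSpace.IsTopologicalBasis
      {s : Set (H n) | ∃ u r, s = Metric.eball u r} := by
    apply TopologicalSpace.isTopologicalBasis_of_isOpen_of_nhds
    · rintro _ ⟨u, r, rfl⟩
      exact Metric.isOpen_eball
    · intro u U hu hU
      obtain ⟨r, hr, h⟩ := EMetric.mem_nhds_iff.1 (hU.mem_nhds hu)
      exact ⟨_, ⟨u, r, rfl⟩, Metric.mem_eball_self hr, h⟩
  have hborel : borel (H n) = MeasurableSpace.generateFrom _ :=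
    borel_eq_generateFrom_of_subbasis hbasis.eq_generateFrom
  have hmem : ∀ x, MemLp (F x) 2 (leb n) ↔ ∫⁻ p, ‖F x p‖ₑ ^ 2 ∂(leb n) < ∞ := fun x =>
    memLp_two_iff_lintegral hF.of_uncurry_left.aestronglyMeasurable
  have hN : MeasurableSet {x | ∫⁻ p, ‖F x p‖ₑ ^ 2 ∂(leb n) < ∞} :=
    measurableSet_lt (Measurable.lintegral_prod_right' (hF.enorm.pow_const 2)) measurable_const
  rw [‹BorelSpace (H n)›.measurable_eq, hborel]
  apply measurable_generateFrom
  rintro _ ⟨u, r, rfl⟩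
  have hu : Measurable u := (Lp.stronglyMeasurable u).measurable
  have hD : MeasurableSet {x | ∫⁻ p, ‖F x p - u p‖ₑ ^ 2 ∂(leb n) < r ^ 2} := by
    refine measurableSet_lt (Measurable.lintegral_prod_right'
      (f := fun z : X × E n => ‖F z.1 z.2 - u z.2‖ₑ ^ 2) ?_) measurable_const
    exact ((hF.sub (hu.comp measurable_snd)).enorm.pow_const 2)
  convert (hN.inter hD).union (hN.compl.inter (MeasurableSet.const ((0 : H n) ∈ Metric.eball u r)))
    using 1
  ext x
  by_cases hx : MemLp (F x) 2 (leb n)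
  · have h1 := (hmem x).1 hx
    simp only [Set.mem_preimage, Metric.mem_eball, Set.mem_union, Set.mem_inter_iff,
      Set.mem_ofPred_eq, h1, true_and, Set.mem_compl_iff, not_true, false_and, or_false]
    rw [← enorm_toL2_sub hx, edist_eq_enorm_sub, ENNReal.pow_lt_pow_left_iff two_ne_zero]
  · have h1 := mt (hmem x).2 hx
    simp only [Set.mem_preimage, Set.mem_union, Set.mem_inter_iff,
      Set.mem_ofPred_eq, h1, false_and, Set.mem_compl_iff, not_false_eq_true, true_and, false_or]
    rw [toL2, dif_neg hx]

theorem memLp_toL2 {ν : Measure X} [SFinite ν] {F : X → E n → ℂ}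
    (hF : Measurable (Function.uncurry F)) (h : MemLp (Function.uncurry F) 2 (ν.prod (leb n))) :
    MemLp (fun x => toL2 (F x)) 2 ν ∧
      eLpNorm (fun x => toL2 (F x)) 2 ν = eLpNorm (Function.uncurry F) 2 (ν.prod (leb n)) := by
  have heq : eLpNorm (fun x => toL2 (F x)) 2 ν = eLpNorm (Function.uncurry F) 2 (ν.prod (leb n)) := by
    apply le_antisymm
    all_goals
      rw [← ENNReal.pow_le_pow_left_iff two_ne_zero, eLpNorm_two_sq, eLpNorm_two_sq,
        lintegral_prod _ (hF.enorm.pow_const 2).aemeasurable]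
      apply lintegral_mono_ae
      filter_upwards [ae_memLp_slice h] with x hx
      first
      | exact (enorm_toL2 hx).le
      | exact (enorm_toL2 hx).ge
  exact ⟨⟨(stronglyMeasurable_toL2 hF).aestronglyMeasurable, heq ▸ h.2⟩, heq⟩

/-- The Bochner integral of the slices is the slice of the integrals. -/
theorem integral_toL2 {κ : Measure X} [IsProbabilityMeasure κ] {F : X → E n → ℂ}
    (hF : Measurable (Function.uncurry F)) (h : MemLp (Function.uncurry F) 2 (κ.prod (leb n))) :
    ∫ s, toL2 (F s) ∂κ = toL2 fun p => ∫ s, F s p ∂κ := by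
  have hswap : MemLp (fun z : E n × X => F z.2 z.1) 2 ((leb n).prod κ) :=
    h.comp_measurePreserving Measure.measurePreserving_swap
  have havg : MemLp (fun p => ∫ s, F s p ∂κ) 2 (leb n) := (memLp_average hswap).1
  refine ext_inner_left ℂ fun u => ?_
  rw [← integral_inner ((memLp_toL2 hF h).1.integrable (by norm_num))]
  have hu : MemLp (fun z : E n × X => u z.1) 2 ((leb n).prod κ) :=
    (Lp.memLp u).comp_measurePreserving measurePreserving_fst
  have hint : Integrable (fun z : E n × X => ⟪u z.1, F z.2 z.1⟫_ℂ) ((leb n).prod κ) :=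
    hswap.integrable_mul hu.star
  rw [L2.inner_def]
  calc ∫ s, ⟪u, toL2 (F s)⟫_ℂ ∂κ = ∫ s, ∫ p, ⟪u p, F s p⟫_ℂ ∂(leb n) ∂κ := by
        apply integral_congr_ae
        filter_upwards [ae_memLp_slice h] with s hs
        rw [L2.inner_def]
        apply integral_congr_ae
        filter_upwards [coeFn_toL2 (g := F s) hs] with p hp
        rw [hp]
    _ = ∫ p, ∫ s, ⟪u p, F s p⟫_ℂ ∂κ ∂(leb n) := (integral_integral_swap hint).symm
    _ = ∫ p, ⟪u p, toL2 (fun p => ∫ s, F s p ∂κ) p⟫_ℂ ∂(leb n) := by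
        apply integral_congr_ae
        filter_upwards [coeFn_toL2 havg, ae_memLp_slice hswap] with p hp hs
        rw [hp, integral_inner (hs.integrable (by norm_num))]

end Slices

section HeavySlices

variable {n : ℕ}

theorem measurable_heavySlice (Φ : H₂ n) :
    Measurable (Function.uncurry fun k p : E n => Φ (p, k)) :=
  (Lp.stronglyMeasurable Φ).measurable.comp measurable_swap

theorem memLp_heavySlice (Φ : H₂ n) :
    MemLp (Function.uncurry fun k p : E n => Φ (p, k)) 2 ((leb n).prod (leb n)) :=
  (Lp.memLp Φ).comp_measurePreserving Measure.measurePreserving_swap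

theorem toL2_heavySlice_congr {Φ Ψ : E n × E n → ℂ} (h : Φ =ᵐ[(leb n).prod (leb n)] Ψ) :
    (fun k => toL2 fun p => Φ (p, k)) =ᵐ[leb n] fun k => toL2 fun p => Ψ (p, k) := by
  have h' := (Measure.measurePreserving_swap (μ := leb n)
    (ν := leb n)).quasiMeasurePreserving.ae_eq_comp h
  filter_upwards [Measure.ae_ae_of_ae_prod h'] with k hk
  exact toL2_congr hk

/-- The isometry `L²(ℝⁿ × ℝⁿ) → L²(ℝⁿ; L²(ℝⁿ))` sending a two-particle vector to the function of
the light momentum `k` with values `Φ (·, k)`. -/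
def heavySlice (n : ℕ) : H₂ n →ₗᵢ[ℂ] Lp (H n) 2 (leb n) where
  toFun Φ := (memLp_toL2 (measurable_heavySlice Φ) (memLp_heavySlice Φ)).1.toLp _
  map_add' Φ Ψ := by
    rw [← MemLp.toLp_add]
    apply MemLp.toLp_congr
    filter_upwards [toL2_heavySlice_congr (Lp.coeFn_add Φ Ψ), ae_memLp_slice (memLp_heavySlice Φ),
      ae_memLp_slice (memLp_heavySlice Ψ)] with k h1 h2 h3
    rw [h1]
    exact toL2_add h2 h3
  map_smul' c Φ := by
    rw [RingHom.id_apply, ← MemLp.toLp_const_smul]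
    apply MemLp.toLp_congr
    filter_upwards [toL2_heavySlice_congr (Lp.coeFn_smul c Φ),
      ae_memLp_slice (memLp_heavySlice Φ)] with k h1 h2
    rw [h1]
    exact toL2_const_mul c h2
  norm_map' Φ := by
    simp only [LinearMap.coe_mk, AddHom.coe_mk, Lp.norm_toLp]
    rw [(memLp_toL2 (measurable_heavySlice Φ) (memLp_heavySlice Φ)).2, Lp.norm_def]
    congr 1
    exact eLpNorm_comp_measurePreserving (Lp.aestronglyMeasurable Φ)
      Measure.measurePreserving_swap

theorem coeFn_heavySlice (Φ : H₂ n) :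
    heavySlice n Φ =ᵐ[leb n] fun k => toL2 fun p => Φ (p, k) :=
  (memLp_toL2 (measurable_heavySlice Φ) (memLp_heavySlice Φ)).1.coeFn_toLp

theorem heavySlice_tmul (v f : H n) :
    heavySlice n (tmul (leb n) (leb n) v f) =ᵐ[leb n] fun k => f k • v := by
  filter_upwards [coeFn_heavySlice (tmul (leb n) (leb n) v f),
    toL2_heavySlice_congr (coeFn_tmul (leb n) (leb n) v f)] with k h1 h2
  rw [h1, h2]
  apply toL2_eq_of_ae
  filter_upwards [Lp.coeFn_smul (f k) v] with p hp
  rw [hp, Pi.smul_apply, smul_eq_mul, mul_comm]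

theorem heavySlice_tensorOp (G : H n →L[ℂ] H n) (Φ : H₂ n) :
    heavySlice n (tensorOp (leb n) (leb n) G 1 Φ) = G.compLp (heavySlice n Φ) := by
  have : (heavySlice n).toContinuousLinearMap ∘L tensorOp (leb n) (leb n) G 1 =
      G.compLpL 2 (leb n) ∘L (heavySlice n).toContinuousLinearMap := by
    apply ext_tmul
    intro v f
    apply Lp.ext
    have h1 : heavySlice n (tensorOp (leb n) (leb n) G 1 (tmul (leb n) (leb n) v f)) =ᵐ[leb n]
        fun k => f k • G v := by
      rw [tensorOp_tmul]
      exact heavySlice_tmul (G v) f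
    refine h1.trans (EventuallyEq.symm ?_)
    filter_upwards [G.coeFn_compLp (heavySlice n (tmul (leb n) (leb n) v f)),
      heavySlice_tmul v f] with k hk1 hk2
    refine hk1.trans ?_
    rw [hk2, map_smul]
  exact DFunLike.congr_fun this Φ

/-- Matrix elements of `G ⊗ I` as integrals over the light momentum. -/
theorem inner_tensorOp_eq_integral (G : H n →L[ℂ] H n) (Φ Ψ : H₂ n) :
    ⟪Φ, tensorOp (leb n) (leb n) G 1 Ψ⟫_ℂ =
      ∫ k, ⟪toL2 fun p => Φ (p, k), G (toL2 fun p => Ψ (p, k))⟫_ℂ ∂(leb n) := by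
  rw [← (heavySlice n).inner_map_map, heavySlice_tensorOp, L2.inner_def]
  apply integral_congr_ae
  filter_upwards [coeFn_heavySlice Φ, coeFn_heavySlice Ψ, G.coeFn_compLp (heavySlice n Ψ)]
    with k h1 h2 h3
  rw [h1, h3, h2]

end HeavySlices

/-! ### Strongly convergent integrals of sesquilinear forms -/

section StrongIntegral

variable {X V W : Type} [MeasurableSpace X] {μ : Measure X}
  [NormedAddCommGroup V] [InnerProductSpace ℂ V] [NormedAddCommGroup W] [InnerProductSpace ℂ W]

/-- A family of vectors `a x v` depending linearly on `v` for almost every `x`, and bounded in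
`L²` by the norm of `v`, defines a bounded operator into the vector-valued `L²` space. -/
theorem exists_clm_coeFn_ae_eq (a : X → V → W) (C : ℝ) (hC : 0 ≤ C)
    (hm : ∀ v, AEStronglyMeasurable (fun x => a x v) μ)
    (hb : ∀ v, eLpNorm (fun x => a x v) 2 μ ≤ ENNReal.ofReal (C * ‖v‖))
    (hadd : ∀ v v', ∀ᵐ x ∂μ, a x (v + v') = a x v + a x v')
    (hsmul : ∀ (c : ℂ) v, ∀ᵐ x ∂μ, a x (c • v) = c • a x v) :
    ∃ A : V →L[ℂ] Lp W 2 μ, ∀ v, A v =ᵐ[μ] fun x => a x v := by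
  have hmem : ∀ v, MemLp (fun x => a x v) 2 μ := fun v =>
    ⟨hm v, (hb v).trans_lt ENNReal.ofReal_lt_top⟩
  refine ⟨LinearMap.mkContinuous
    { toFun := fun v => (hmem v).toLp _
      map_add' := fun v v' => by
        rw [← MemLp.toLp_add]
        exact MemLp.toLp_congr _ _ (hadd v v')
      map_smul' := fun c v => by
        rw [RingHom.id_apply, ← MemLp.toLp_const_smul]
        exact MemLp.toLp_congr _ _ (hsmul c v) } C (fun v => ?_), fun v => (hmem v).coeFn_toLp⟩
  simp only [LinearMap.coe_mk, AddHom.coe_mk, Lp.norm_toLp]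
  exact ENNReal.toReal_le_of_le_ofReal (by positivity) (hb v)

theorem memLp_indicator_one {F : Set X} (hF : MeasurableSet F) (μ : Measure X) :
    MemLp (F.indicator fun _ => (1 : ℂ)) ∞ μ :=
  memLp_top_of_bound (measurable_const.indicator hF).aestronglyMeasurable 1
    (Eventually.of_forall fun x => by by_cases hx : x ∈ F <;> simp [hx])

/-- Multiplication by the indicator function of a measurable set, on the vector-valued `L²`. -/
def cutoff (μ : Measure X) (W : Type) [NormedAddCommGroup W] [InnerProductSpace ℂ W]
    {F : Set X} (hF : MeasurableSet F) : Lp W 2 μ →L[ℂ] Lp W 2 μ :=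
  (ContinuousLinearMap.lsmul ℂ ℂ).holderL μ ∞ 2 2 ((memLp_indicator_one hF μ).toLp _)

theorem coeFn_cutoff {F : Set X} (hF : MeasurableSet F) (u : Lp W 2 μ) :
    cutoff μ W hF u =ᵐ[μ] F.indicator u := by
  filter_upwards [(memLp_indicator_one hF μ).coeFn_toLp,
    (ContinuousLinearMap.lsmul ℂ ℂ : ℂ →L[ℂ] W →L[ℂ] W).coeFn_holder (r := 2)
      ((memLp_indicator_one hF μ).toLp _) u] with x h1 h2
  refine h2.trans ?_
  rw [h1]
  by_cases hx : x ∈ F <;> simp [hx]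

theorem tendsto_cutoff {F : ℕ → Set X} (hF : ∀ N, MeasurableSet (F N)) (hmono : Monotone F)
    (hU : (⋃ N, F N) = Set.univ) (u : Lp W 2 μ) :
    Tendsto (fun N => cutoff μ W (hF N) u) atTop (𝓝 u) := by
  rw [Lp.tendsto_Lp_iff_tendsto_eLpNorm']
  have hsq : Tendsto (fun N => eLpNorm (⇑(cutoff μ W (hF N) u) - ⇑u) 2 μ ^ 2) atTop (𝓝 0) := by
    simp only [eLpNorm_two_sq]
    have hu := (memLp_two_iff_lintegral (Lp.aestronglyMeasurable u)).1 (Lp.memLp u)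
    have hlim := tendsto_lintegral_of_dominated_convergence' (μ := μ)
      (F := fun N x => ‖(cutoff μ W (hF N) u - ⇑u) x‖ₑ ^ 2) (f := fun _ => 0)
      (fun x => ‖u x‖ₑ ^ 2)
      (fun N => (((Lp.aestronglyMeasurable _).sub (Lp.aestronglyMeasurable u)).enorm.pow_const 2))
      (fun N => by
        filter_upwards [coeFn_cutoff (hF N) u] with x hx
        rw [Pi.sub_apply, hx]
        by_cases h : x ∈ F N <;> simp [h])
      hu.ne (by
        filter_upwards [ae_all_iff.2 fun N => coeFn_cutoff (hF N) u] with x hx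
        obtain ⟨N₀, h₀⟩ := Set.mem_iUnion.1 (hU ▸ Set.mem_univ x : x ∈ ⋃ N, F N)
        apply tendsto_const_nhds.congr'
        filter_upwards [eventually_ge_atTop N₀] with N hN
        rw [Pi.sub_apply, hx N, Set.indicator_of_mem (hmono hN h₀)]
        simp)
    simpa using hlim
  have := ((ENNReal.continuous_rpow_const (y := (1 / 2 : ℝ))).tendsto 0).comp hsq
  rw [ENNReal.zero_rpow_of_pos (by norm_num)] at this
  refine this.congr fun N => ?_
  rw [Function.comp_apply, ← ENNReal.rpow_natCast, ← ENNReal.rpow_mul]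
  norm_num

/-- Families of vectors given by bounded operators into the vector-valued `L²` space yield a
strongly convergent integral of sesquilinear forms: restricting the integral to a subset of the
parameter space amounts to inserting a cutoff, and the cutoffs converge strongly to the identity. -/
theorem exists_isStrongIntegral [CompleteSpace V] [CompleteSpace W] (a₁ a₂ : X → V → W)
    (A₁ A₂ : V →L[ℂ] Lp W 2 μ) (h₁ : ∀ v, A₁ v =ᵐ[μ] fun x => a₁ x v)
    (h₂ : ∀ v, A₂ v =ᵐ[μ] fun x => a₂ x v) (G : W →L[ℂ] W) :
    ∃ B : V →L[ℂ] V, IsStrongIntegral μ (fun x v w => ⟪a₁ x v, G (a₂ x w)⟫_ℂ) B := by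
  have hG : ∀ w, G.compLpL 2 μ (A₂ w) =ᵐ[μ] fun x => G (a₂ x w) := fun w => by
    filter_upwards [G.coeFn_compLp (A₂ w), h₂ w] with x e1 e2
    exact e1.trans (congrArg G e2)
  have hQ : ∀ v w, (fun x => ⟪A₁ v x, G.compLpL 2 μ (A₂ w) x⟫_ℂ) =ᵐ[μ]
      fun x => ⟪a₁ x v, G (a₂ x w)⟫_ℂ := fun v w => by
    filter_upwards [h₁ v, hG w] with x e1 e2
    rw [e1, e2]
  refine ⟨ContinuousLinearMap.adjoint A₁ ∘L G.compLpL 2 μ ∘L A₂, fun v w => ?_, fun v w => ?_,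
    fun F hF hmono hU => ?_⟩
  · exact (L2.integrable_inner (𝕜 := ℂ) (A₁ v) (G.compLpL 2 μ (A₂ w))).congr (hQ v w)
  · rw [ContinuousLinearMap.comp_apply, ContinuousLinearMap.adjoint_inner_right, L2.inner_def]
    exact integral_congr_ae (hQ v w)
  · refine ⟨fun N => ContinuousLinearMap.adjoint A₁ ∘L cutoff μ W (hF N) ∘L G.compLpL 2 μ ∘L A₂,
      fun N v w => ?_, fun w => ?_⟩
    · rw [ContinuousLinearMap.comp_apply, ContinuousLinearMap.adjoint_inner_right, L2.inner_def,
        ← integral_indicator (hF N)]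
      apply integral_congr_ae
      filter_upwards [hQ v w, coeFn_cutoff (hF N) (G.compLpL 2 μ (A₂ w))] with x e1 e2
      rw [ContinuousLinearMap.comp_apply, ContinuousLinearMap.comp_apply, e2]
      by_cases hx : x ∈ F N
      · rw [Set.indicator_of_mem hx, Set.indicator_of_mem hx]
        exact e1
      · rw [Set.indicator_of_notMem hx, Set.indicator_of_notMem hx, inner_zero_right]
    · exact ((ContinuousLinearMap.adjoint A₁).continuous.tendsto _).comp
        (tendsto_cutoff hF hmono hU (G.compLpL 2 μ (A₂ w)))

end StrongIntegral

/-! ### The partial trace -/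

section Trace

variable {V : Type} [NormedAddCommGroup V] [InnerProductSpace ℂ V]

theorem hasSum_norm_inner_sq {ι : Type} (e : HilbertBasis ι ℂ V) (x : V) :
    HasSum (fun l => ‖⟪e l, x⟫_ℂ‖ ^ 2) (‖x‖ ^ 2) := by
  have h := Complex.reCLM.hasSum (e.hasSum_inner_mul_inner x x)
  simp only [Complex.reCLM_apply] at h
  convert h using 1
  · ext l
    rw [← inner_conj_symm x (e l), mul_comm, Complex.mul_conj, Complex.ofReal_re,
      Complex.normSq_eq_norm_sq]
  · exact norm_sq_eq_re_inner (𝕜 := ℂ) x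

/-- The trace of `ρ C` for `ρ = ∑ⱼ βⱼ |fⱼ⟩⟨fⱼ|`, in an arbitrary orthonormal basis `(eₗ)`: the double
series over `(j, l)` converges absolutely, and Parseval's identity evaluates its rows. -/
theorem hasSum_trace_mul [CompleteSpace V] {ρ : V →L[ℂ] V} {β : ℕ → ℝ} {f : ℕ → V} (hβ : ∀ j, 0 ≤ β j)
    (hβs : Summable β) (hf : Orthonormal ℂ f)
    (hρ : HasSum (fun j => (β j : ℂ) • InnerProductSpace.rankOne ℂ (f j) (f j)) ρ)
    (C : V →L[ℂ] V) {ι : Type} (e : HilbertBasis ι ℂ V) :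
    HasSum (fun l => ⟪e l, ρ (C (e l))⟫_ℂ) (∑' j, (β j : ℂ) * ⟪f j, C (f j)⟫_ℂ) := by
  set x : ℕ → V := fun j => ContinuousLinearMap.adjoint C (f j) with hx
  set g : ℕ × ι → ℂ := fun z => (β z.1 : ℂ) * (⟪x z.1, e z.2⟫_ℂ * ⟪e z.2, f z.1⟫_ℂ) with hg
  -- twice a product is at most the sum of the squares, and Parseval's identity sums the squares over `l`
  have hbound : Summable fun z : ℕ × ι =>
      β z.1 * (‖⟪e z.2, x z.1⟫_ℂ‖ ^ 2 + ‖⟪e z.2, f z.1⟫_ℂ‖ ^ 2) := by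
    have hfib : ∀ j, HasSum (fun l => β j * (‖⟪e l, x j⟫_ℂ‖ ^ 2 + ‖⟪e l, f j⟫_ℂ‖ ^ 2))
        (β j * (‖x j‖ ^ 2 + ‖f j‖ ^ 2)) := fun j =>
      ((hasSum_norm_inner_sq e (x j)).add (hasSum_norm_inner_sq e (f j))).mul_left _
    rw [summable_prod_of_nonneg (fun z => mul_nonneg (hβ _) (by positivity))]
    refine ⟨fun j => (hfib j).summable, ?_⟩
    simp only [fun j => (hfib j).tsum_eq]
    refine Summable.of_nonneg_of_le (fun j => mul_nonneg (hβ _) (by positivity)) (fun j => ?_)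
      (hβs.mul_right (‖ContinuousLinearMap.adjoint C‖ ^ 2 + 1))
    refine mul_le_mul_of_nonneg_left ?_ (hβ j)
    have h1 : ‖x j‖ ≤ ‖ContinuousLinearMap.adjoint C‖ := by
      simpa [hf.1 j] using (ContinuousLinearMap.adjoint C).le_opNorm (f j)
    rw [hf.1 j, one_pow]
    gcongr
  have hgs : Summable g := by
    refine Summable.of_norm_bounded hbound fun z => ?_
    rw [hg]
    simp only [norm_mul, Complex.norm_real, Real.norm_of_nonneg (hβ _)]
    refine mul_le_mul_of_nonneg_left ?_ (hβ _)
    rw [norm_inner_symm (x z.1)]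
    nlinarith [sq_nonneg (‖⟪e z.2, x z.1⟫_ℂ‖ - ‖⟪e z.2, f z.1⟫_ℂ‖),
      sq_nonneg ‖⟪e z.2, x z.1⟫_ℂ‖, sq_nonneg ‖⟪e z.2, f z.1⟫_ℂ‖]
  have hrow : ∀ j, HasSum (fun l => g (j, l)) ((β j : ℂ) * ⟪f j, C (f j)⟫_ℂ) := fun j => by
    rw [← ContinuousLinearMap.adjoint_inner_left]
    exact (e.hasSum_inner_mul_inner (x j) (f j)).mul_left _
  have hcol : ∀ l, HasSum (fun j => g (j, l)) ⟪e l, ρ (C (e l))⟫_ℂ := fun l => by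
    have h1 := ((innerSL ℂ (e l)) ∘L (ContinuousLinearMap.apply ℂ V (C (e l)))).hasSum hρ
    have h2 : ∀ j, ((innerSL ℂ (e l)) ∘L (ContinuousLinearMap.apply ℂ V (C (e l))))
        ((β j : ℂ) • InnerProductSpace.rankOne ℂ (f j) (f j)) = g (j, l) := fun j => by
      simp [hg, hx, InnerProductSpace.rankOne_apply, ContinuousLinearMap.adjoint_inner_left]
    simp only [h2] at h1
    exact h1
  have hsum := hgs.hasSum.prod_fiberwise hrow
  rw [hsum.tsum_eq]
  exact ((Equiv.prodComm ι ℕ).hasSum_iff.2 hgs.hasSum).prod_fiberwise hcol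

end Trace

section PartialTrace

variable {X Y : Type} [MeasurableSpace X] [MeasurableSpace Y]
  {μ : Measure X} {ν : Measure Y} [SigmaFinite μ] [SigmaFinite ν]

/-- The partial trace of `(I ⊗ ρ) C` for `ρ = ∑ⱼ βⱼ |fⱼ⟩⟨fⱼ|`. For fixed `v`, `w` it is the trace of
`ρ` times the compression of `C` by the maps `f ↦ v ⊗ f` and `f ↦ w ⊗ f`. -/
theorem isPartialTrace_of_inner_eq {ρ : L2 ν →L[ℂ] L2 ν} {β : ℕ → ℝ} {f : ℕ → L2 ν}
    (hβ : ∀ j, 0 ≤ β j) (hβs : Summable β) (hf : Orthonormal ℂ f)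
    (hρ : HasSum (fun j => (β j : ℂ) • InnerProductSpace.rankOne ℂ (f j) (f j)) ρ)
    (C : L2 (μ.prod ν) →L[ℂ] L2 (μ.prod ν)) (B : L2 μ →L[ℂ] L2 μ)
    (hB : ∀ v w, ⟪v, B w⟫_ℂ =
      ∑' j, (β j : ℂ) * ⟪tmul μ ν v (f j), C (tmul μ ν w (f j))⟫_ℂ) :
    IsPartialTrace μ ν (tensorOp μ ν 1 ρ ∘L C) B := by
  intro ι e v w
  have hT (v : L2 μ) : ∃ T : L2 ν →L[ℂ] L2 (μ.prod ν), ∀ f, T f = tmul μ ν v f :=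
    ⟨(tmulₗ μ ν v).mkContinuous ‖v‖ fun f => (norm_tmul v f).le, fun f => rfl⟩
  obtain ⟨Tv, hTv⟩ := hT v
  obtain ⟨Tw, hTw⟩ := hT w
  have h := hasSum_trace_mul hβ hβs hf hρ (ContinuousLinearMap.adjoint Tv ∘L C ∘L Tw) e
  simp only [← ContinuousLinearMap.adjoint_inner_left ρ, ContinuousLinearMap.comp_apply,
    ContinuousLinearMap.adjoint_inner_right Tv, hTv, hTw] at h
  rw [hB]
  convert h using 2 with l
  rw [ContinuousLinearMap.comp_apply, inner_tmul_tensorOp, ← ContinuousLinearMap.star_eq_adjoint,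
    star_one, one_apply_eq_self]

end PartialTrace

/-! ### The operators under the integral -/

section Integrand

variable {n : ℕ}

/-- `det ((I + λσ)/(1 + λ))` is positive: the determinant of `I + tσ` does not vanish for
`0 ≤ t < 1`, as `σ` is an isometry, and equals `1` at `t = 0`. -/
theorem det_mixMat_pos {lam : ℝ} (h0 : 0 ≤ lam) (h1 : lam < 1) (σ : rotations n) :
    0 < (mixMat lam σ).det := by
  have hcont : Continuous fun t : ℝ => (1 + t • rotMat σ).det :=
    (continuous_const.add (continuous_id.smul continuous_const)).matrix_det
  have hne : ∀ t ∈ Set.Icc 0 lam, (1 + t • rotMat σ).det ≠ 0 := by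
    intro t ht hdet
    obtain ⟨x, hx, hx0⟩ := Matrix.exists_mulVec_eq_zero_iff.2 hdet
    have h2 : act (1 + t • rotMat σ) (WithLp.toLp 2 x) = 0 := by
      apply WithLp.ofLp_injective 2
      exact (Matrix.ofLp_toEuclideanCLM _ _).trans hx0
    have h3 : act (1 + t • rotMat σ) (WithLp.toLp 2 x) =
        WithLp.toLp 2 x + t • act (rotMat σ) (WithLp.toLp 2 x) := by
      simp [act]
    rw [h3] at h2
    have h4 := congrArg norm (eq_neg_of_add_eq_zero_left h2)
    rw [norm_neg, norm_smul, norm_act_rotMat, Real.norm_of_nonneg ht.1] at h4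
    have h5 : 0 < ‖WithLp.toLp 2 x‖ := by
      rw [norm_pos_iff]
      exact fun h => hx (congrArg WithLp.ofLp h)
    nlinarith [ht.2]
  have hpos : 0 < (1 + lam • rotMat σ).det := by
    by_contra hneg
    obtain ⟨t, ht, ht0⟩ := intermediate_value_Icc' h0 hcont.continuousOn
      (show (0 : ℝ) ∈ Set.Icc _ _ from ⟨not_lt.1 hneg, by simp⟩)
    exact hne t ht ht0
  rw [mixMat, Matrix.det_smul]
  positivity

/-- The heavy momentum after the collision is the substitution implemented by `U_{k,σ,λ}`. -/
theorem fst_collide {lam : ℝ} (h : 1 + lam ≠ 0) (p k : E n) (σ : rotations n) :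
    (collide lam ((p, k), σ)).1 = act (mixMat lam σ) (p + k) - act (rotMat σ) k := by
  have h1 : act (mixMat lam σ) (p + k) =
      (1 + lam)⁻¹ • (p + k + lam • (act (rotMat σ) p + act (rotMat σ) k)) := by
    simp [act, mixMat]
  have h2 : act (rotMat σ - 1) (k - lam • p) =
      act (rotMat σ) k - lam • act (rotMat σ) p - (k - lam • p) := by
    simp [act]
  rw [h1, collide]
  simp only
  rw [h2]
  generalize act (rotMat σ) k = k'
  generalize act (rotMat σ) p = p'
  ext i
  simp
  field_simp
  ring

theorem quasiMeasurePreserving_act {A : Matrix (Fin n) (Fin n) ℝ} (hA : A.det ≠ 0) :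
    Measure.QuasiMeasurePreserving (fun p => act A p) (leb n) (leb n) := by
  have hdet : LinearMap.det (Matrix.toEuclideanCLM (n := Fin n) (𝕜 := ℝ) A).toLinearMap
      = A.det := by
    change LinearMap.det (Matrix.toLpLin 2 2 A) = A.det
    rw [Matrix.toLpLin_eq_toLin, LinearMap.det_toLin]
  have hmap : (leb n).map (fun p => act A p) = ENNReal.ofReal |(A.det)⁻¹| • leb n := by
    have h := Measure.map_linearMap_addHaar_eq_smul_addHaar (leb n)
      (f := (Matrix.toEuclideanCLM (n := Fin n) (𝕜 := ℝ) A).toLinearMap) (by rwa [hdet])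
    rw [hdet] at h
    exact h
  refine ⟨(Matrix.toEuclideanCLM (n := Fin n) (𝕜 := ℝ) A).continuous.measurable, ?_⟩
  rw [hmap]
  exact Measure.smul_absolutelyContinuous

theorem quasiMeasurePreserving_fst_collide {lam : ℝ} (h0 : 0 ≤ lam) (h1 : lam < 1) (k : E n)
    (σ : rotations n) :
    Measure.QuasiMeasurePreserving (fun p => (collide lam ((p, k), σ)).1) (leb n) (leb n) := by
  have h := (measurePreserving_sub_right (leb n) (act (rotMat σ) k)).quasiMeasurePreserving.comp
    ((quasiMeasurePreserving_act (det_mixMat_pos h0 h1 σ).ne').comp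
      (measurePreserving_add_right (leb n) k).quasiMeasurePreserving)
  convert h using 1
  ext1 p
  exact fst_collide (by positivity) p k σ

theorem coeFn_shift (a : E n) (w : H n) : shift a w =ᵐ[leb n] fun p => w (p - a) :=
  Lp.coeFn_compMeasurePreserving w (measurePreserving_sub_right volume a)

theorem adjoint_shift (a : E n) : ContinuousLinearMap.adjoint (shift a) = shift (-a) := by
  have h : shift a ∘L shift (-a) = 1 := by
    ext1 w
    apply Lp.ext
    filter_upwards [coeFn_shift a (shift (-a) w),
      (measurePreserving_sub_right (leb n) a).quasiMeasurePreserving.ae_eq_comp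
        (coeFn_shift (-a) w)] with p h1 h2
    refine h1.trans (h2.trans ?_)
    simp
  have h2 : ContinuousLinearMap.adjoint (shift a) ∘L shift a = 1 :=
    adjoint_comp_self_compMeasurePreserving (measurePreserving_sub_right (leb n) a)
  calc ContinuousLinearMap.adjoint (shift a) =
      ContinuousLinearMap.adjoint (shift a) ∘L (shift a ∘L shift (-a)) := by
        rw [h]; exact (ContinuousLinearMap.comp_id _).symm
    _ = shift (-a) := by
        rw [← ContinuousLinearMap.comp_assoc, h2]; exact ContinuousLinearMap.id_comp _

theorem coeFn_opU {lam : ℝ} (h0 : 0 ≤ lam) (h1 : lam < 1) (k : E n) (σ : rotations n) (w : H n) :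
    opU lam k σ w =ᵐ[leb n]
      fun p => (Real.sqrt (mixMat lam σ).det : ℂ) * w (collide lam ((p, k), σ)).1 := by
  have hdet := det_mixMat_pos h0 h1 σ
  have hk := (measurePreserving_sub_right (leb n) (-k)).quasiMeasurePreserving
  have e1 := coeFn_shift (-k) (dilation (mixMat lam σ) (shift (act (rotMat σ) k) w))
  have e2 := hk.ae_eq_comp (coeFn_toL2
    (memLp_dilation (mixMat lam σ) hdet.ne' (shift (act (rotMat σ) k) w)))
  have e3 := hk.ae_eq_comp ((quasiMeasurePreserving_act hdet.ne').ae_eq_comp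
    (coeFn_shift (act (rotMat σ) k) w))
  rw [opU, adjoint_shift]
  filter_upwards [e1, e2, e3] with p e1 e2 e3
  refine e1.trans (e2.trans ?_)
  simp only [Function.comp_apply] at e3 ⊢
  rw [e3, abs_of_pos hdet, fst_collide (by positivity), sub_neg_eq_add]

/-- The function `√β v(K') f(k')`, where `(K', k')` are the momenta obtained from `(p, k)` by the
collision with rotation `σ`. -/
def collisionFun (lam β : ℝ) (v f : H n) (k : E n) (σ : rotations n) (p : E n) : ℂ :=
  (Real.sqrt β : ℂ) * (v (collide lam ((p, k), σ)).1 * f (collide lam ((p, k), σ)).2)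

/-- The determinant factors of `m_{j,k,σ,λ}` and of `U_{k,σ,λ}` cancel. -/
theorem symbM_mul_opU {lam : ℝ} (h0 : 0 ≤ lam) (h1 : lam < 1) (β : ℝ) (f : H n) (k : E n)
    (σ : rotations n) (w : H n) :
    (fun p => symbM lam β f k σ p * opU lam k σ w p) =ᵐ[leb n]
      collisionFun lam β w f k σ := by
  have hdet := det_mixMat_pos h0 h1 σ
  filter_upwards [coeFn_opU h0 h1 k σ w] with p hp
  have h2 : (((mixMat lam σ).det ^ (-(1 / 2) : ℝ) : ℝ) : ℂ) * (Real.sqrt (mixMat lam σ).det : ℂ)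
      = 1 := by
    rw [← Complex.ofReal_mul, Real.sqrt_eq_rpow, ← Real.rpow_add hdet]
    norm_num
  have h3 : k + (1 + lam)⁻¹ • act (rotMat σ - 1) (k - lam • p) = (collide lam ((p, k), σ)).2 := rfl
  rw [hp, symbM, collisionFun, Complex.ofReal_mul, h3]
  linear_combination ((Real.sqrt β : ℂ) * f (collide lam ((p, k), σ)).2 *
    w (collide lam ((p, k), σ)).1) * h2

theorem memLp_symbS_mul (c lam : ℝ) (k : E n) {g : E n → ℂ} (hg : MemLp g 2 (leb n)) :
    MemLp (fun p => symbS n c lam k p * g p) 2 (leb n) := by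
  have hm : Measurable fun p => symbS n c lam k p :=
    (measurable_symbS n c lam).comp (f := fun p => (p, k)) (by fun_prop)
  refine hg.of_le_mul (c := 2) (hm.aestronglyMeasurable.mul hg.1) (Eventually.of_forall fun p => ?_)
  rw [norm_mul]
  exact mul_le_mul_of_nonneg_right (norm_scatCoeff_le _ _ _ _) (norm_nonneg _)

theorem opSMU_eq_toL2 {lam : ℝ} (h0 : 0 ≤ lam) (h1 : lam < 1) (c β : ℝ) (f : H n) (k : E n)
    (σ : rotations n) (w : H n) (h : MemLp (collisionFun lam β w f k σ) 2 (leb n)) :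
    opSMU c lam β f k σ w =
      toL2 fun p => symbS n c lam k p * collisionFun lam β w f k σ p := by
  have e : mulOp (symbM lam β f k σ) (opU lam k σ w) = toL2 (collisionFun lam β w f k σ) :=
    toL2_congr (symbM_mul_opU h0 h1 β f k σ w)
  rw [opSMU, e, mulOp]
  apply toL2_congr
  filter_upwards [coeFn_toL2 h] with p hp
  rw [hp]

theorem measurable_collisionFun (lam β : ℝ) (v f : H n) :
    Measurable fun z : (E n × E n) × rotations n => collisionFun lam β v f z.1.2 z.2 z.1.1 := by
  have hc := (continuous_collide (n := n) lam).measurable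
  exact (((Lp.stronglyMeasurable v).measurable.comp (measurable_fst.comp hc)).mul
    ((Lp.stronglyMeasurable f).measurable.comp (measurable_snd.comp hc))).const_mul _

/-- For each rotation, the collision preserves Lebesgue measure, hence `L²` norms. -/
theorem lintegral_collisionFun {lam : ℝ} (h0 : 0 ≤ lam) {β : ℝ} (hβ : 0 ≤ β) (v f : H n)
    (σ : rotations n) :
    ∫⁻ k, ∫⁻ p, ‖collisionFun lam β v f k σ p‖ₑ ^ 2 ∂(leb n) ∂(leb n) =
      ENNReal.ofReal (β * (‖v‖ * ‖f‖) ^ 2) := by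
  have hm : Measurable fun z : E n × E n => collisionFun lam β v f z.2 σ z.1 :=
    (measurable_collisionFun lam β v f).comp (f := fun z : E n × E n => (z, σ)) (by fun_prop)
  have hT : Measurable fun z : E n × E n => ‖v z.1 * f z.2‖ₑ ^ 2 :=
    ((((Lp.stronglyMeasurable v).measurable.comp measurable_fst).mul
      ((Lp.stronglyMeasurable f).measurable.comp measurable_snd)).enorm.pow_const 2)
  have hsq : ‖(Real.sqrt β : ℂ)‖ₑ ^ 2 = ENNReal.ofReal β := by
    rw [← ofReal_norm, Complex.norm_real, Real.norm_of_nonneg (Real.sqrt_nonneg _),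
      ← ENNReal.ofReal_pow (Real.sqrt_nonneg _), Real.sq_sqrt hβ]
  have hnorm : ∫⁻ z, ‖v z.1 * f z.2‖ₑ ^ 2 ∂((leb n).prod (leb n)) =
      ENNReal.ofReal ((‖v‖ * ‖f‖) ^ 2) := by
    rw [← eLpNorm_two_sq, ← norm_tmul (μ := leb n) (ν := leb n),
      ENNReal.ofReal_pow (norm_nonneg _), ofReal_norm, Lp.enorm_def]
    congr 1
    exact (eLpNorm_congr_ae (coeFn_tmul (leb n) (leb n) v f)).symm
  calc ∫⁻ k, ∫⁻ p, ‖collisionFun lam β v f k σ p‖ₑ ^ 2 ∂(leb n) ∂(leb n)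
      = ∫⁻ z, ‖collisionFun lam β v f z.2 σ z.1‖ₑ ^ 2 ∂((leb n).prod (leb n)) :=
        (lintegral_prod_symm' _ (hm.enorm.pow_const 2)).symm
    _ = ∫⁻ z, ENNReal.ofReal β * ‖v z.1 * f z.2‖ₑ ^ 2 ∂((leb n).prod (leb n)) := by
        rw [← (measurePreserving_collide (by positivity) σ).lintegral_comp (hT.const_mul _)]
        simp only [collisionFun, enorm_mul, mul_pow, hsq]
    _ = ENNReal.ofReal (β * (‖v‖ * ‖f‖) ^ 2) := by
        rw [lintegral_const_mul _ hT, hnorm, ENNReal.ofReal_mul hβ]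

/-- For almost every `k`, the vector `U_{k,σ,λ} w` belongs to the domain of `m_{j,k,σ,λ}`. -/
theorem ae_inMulDomain {lam : ℝ} (h0 : 0 ≤ lam) (h1 : lam < 1) {β : ℝ} (hβ : 0 ≤ β) (f : H n)
    (σ : rotations n) (w : H n) :
    ∀ᵐ k ∂(leb n), InMulDomain (symbM lam β f k σ) (opU lam k σ w) := by
  have hm : Measurable fun z : E n × E n => collisionFun lam β w f z.1 σ z.2 :=
    (measurable_collisionFun lam β w f).comp (f := fun z : E n × E n => ((z.2, z.1), σ))
      (by fun_prop)
  have hfin : ∫⁻ k, ∫⁻ p, ‖collisionFun lam β w f k σ p‖ₑ ^ 2 ∂(leb n) ∂(leb n) ≠ ∞ := by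
    rw [lintegral_collisionFun h0 hβ]
    exact ENNReal.ofReal_ne_top
  filter_upwards [ae_lt_top (hm.enorm.pow_const 2).lintegral_prod_right' hfin] with k hk
  refine (memLp_congr_ae (symbM_mul_opU h0 h1 β f k σ w)).2 ?_
  exact (memLp_two_iff_lintegral (hm.comp measurable_prodMk_left).aestronglyMeasurable).2 hk

end Integrand

/-! ### Square integrability over the parameter space -/

section Parameters

variable {n : ℕ}

/-- The parameter space of `(j, k, σ₁, σ₂)`. -/
abbrev Param (n : ℕ) : Type := ℕ × E n × rotations n × rotations n

instance (n : ℕ) : SFinite (paramMeasure n) := by unfold paramMeasure; infer_instance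

/-- The collision function for the parameter `x = (j, k, σ₁, σ₂)`; the rotation is `s (σ₁, σ₂)`,
where `s` is one of the two projections. -/
def paramFun (lam : ℝ) (β : ℕ → ℝ) (f : ℕ → H n) (s : rotations n × rotations n → rotations n)
    (v : H n) (x : Param n) (p : E n) : ℂ :=
  collisionFun lam (β x.1) v (f x.1) x.2.1 (s x.2.2) p

variable {lam : ℝ} {β : ℕ → ℝ} {f : ℕ → H n} {s : rotations n × rotations n → rotations n}

theorem measurable_paramFun (lam : ℝ) (β : ℕ → ℝ) (f : ℕ → H n) (hs : Measurable s) (v : H n) :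
    Measurable (Function.uncurry (paramFun lam β f s v)) := by
  have h : Measurable fun z : ℕ × ((E n × E n) × rotations n) =>
      collisionFun lam (β z.1) v (f z.1) z.2.1.2 z.2.2 z.2.1.1 :=
    measurable_from_prod_countable_right fun j => measurable_collisionFun lam (β j) v (f j)
  exact h.comp (f := fun z : Param n × E n => (z.1.1, ((z.2, z.1.2.1), s z.1.2.2))) (by fun_prop)

theorem lintegral_paramFun_le (h0 : 0 ≤ lam) (hβ : ∀ j, 0 ≤ β j) (hβs : Summable β)
    (hf : ∀ j, ‖f j‖ = 1) (hs : Measurable s) (v : H n) :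
    ∫⁻ x, ∫⁻ p, ‖paramFun lam β f s v x p‖ₑ ^ 2 ∂(leb n) ∂(paramMeasure n) ≤
      ENNReal.ofReal ((∑' j, β j) * ‖v‖ ^ 2) := by
  have hm : Measurable fun x => ∫⁻ p, ‖paramFun lam β f s v x p‖ₑ ^ 2 ∂(leb n) :=
    ((measurable_paramFun lam β f hs v).enorm.pow_const 2).lintegral_prod_right'
  rw [paramMeasure, lintegral_prod _ hm.aemeasurable, lintegral_count]
  have hj : ∀ j, ∫⁻ y, ∫⁻ p, ‖paramFun lam β f s v (j, y) p‖ₑ ^ 2 ∂(leb n)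
      ∂((leb n).prod ((haarRot n).prod (haarRot n))) = ENNReal.ofReal (β j * ‖v‖ ^ 2) := by
    intro j
    have hmj : Measurable fun y => ∫⁻ p, ‖paramFun lam β f s v (j, y) p‖ₑ ^ 2 ∂(leb n) :=
      hm.comp measurable_prodMk_left
    rw [lintegral_prod_symm' _ hmj]
    simp only [paramFun, lintegral_collisionFun h0 (hβ j), hf, mul_one, lintegral_const,
      measure_univ]
  simp only [hj]
  rw [← ENNReal.ofReal_tsum_of_nonneg (fun j => mul_nonneg (hβ j) (sq_nonneg _))
    (hβs.mul_right _), tsum_mul_right]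

theorem ae_memLp_paramFun (h0 : 0 ≤ lam) (hβ : ∀ j, 0 ≤ β j) (hβs : Summable β)
    (hf : ∀ j, ‖f j‖ = 1) (hs : Measurable s) (v : H n) :
    ∀ᵐ x ∂(paramMeasure n), MemLp (paramFun lam β f s v x) 2 (leb n) := by
  have hm := measurable_paramFun lam β f hs v
  filter_upwards [ae_lt_top (hm.enorm.pow_const 2).lintegral_prod_right'
    ((lintegral_paramFun_le h0 hβ hβs hf hs v).trans_lt ENNReal.ofReal_lt_top).ne] with x hx
  exact (memLp_two_iff_lintegral (hm.of_uncurry_left).aestronglyMeasurable).2 hx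

/-- The vectors `S_λ m U v` as slices of a function on the parameter space times `ℝⁿ`. This holds only
almost everywhere, as `mulOp` vanishes outside the domain of the multiplication operator. -/
theorem ae_opSMU_eq (h0 : 0 ≤ lam) (h1 : lam < 1) (hβ : ∀ j, 0 ≤ β j) (hβs : Summable β)
    (hf : ∀ j, ‖f j‖ = 1) (hs : Measurable s) (c : ℝ) (v : H n) :
    ∀ᵐ x ∂(paramMeasure n), opSMU c lam (β x.1) (f x.1) x.2.1 (s x.2.2) v =
      toL2 fun p => symbS n c lam x.2.1 p * paramFun lam β f s v x p := by
  filter_upwards [ae_memLp_paramFun h0 hβ hβs hf hs v] with x hx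
  exact opSMU_eq_toL2 h0 h1 c _ _ _ _ _ hx

theorem measurable_symbS_mul_paramFun (c lam : ℝ) (β : ℕ → ℝ) (f : ℕ → H n) (hs : Measurable s)
    (v : H n) :
    Measurable (Function.uncurry fun (x : Param n) p =>
      symbS n c lam x.2.1 p * paramFun lam β f s v x p) :=
  ((measurable_symbS n c lam).comp (f := fun z : Param n × E n => (z.2, z.1.2.1))
    (by fun_prop)).mul (measurable_paramFun lam β f hs v)

theorem enorm_symbS_mul_sq_le (c lam : ℝ) (k p : E n) (z : ℂ) :
    ‖symbS n c lam k p * z‖ₑ ^ 2 ≤ 4 * ‖z‖ₑ ^ 2 := by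
  have h : ‖symbS n c lam k p‖ₑ ≤ 2 := by
    rw [← ofReal_norm]
    exact ENNReal.ofReal_le_of_le_toReal (norm_scatCoeff_le n c lam _)
  rw [enorm_mul, mul_pow]
  refine mul_le_mul_left ((pow_le_pow_left' h 2).trans_eq ?_) _
  norm_num

theorem lintegral_symbS_mul_paramFun_le (h0 : 0 ≤ lam) (hβ : ∀ j, 0 ≤ β j) (hβs : Summable β)
    (hf : ∀ j, ‖f j‖ = 1) (hs : Measurable s) (c : ℝ) (v : H n) :
    ∫⁻ x, ∫⁻ p, ‖symbS n c lam x.2.1 p * paramFun lam β f s v x p‖ₑ ^ 2 ∂(leb n)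
      ∂(paramMeasure n) ≤ 4 * ENNReal.ofReal ((∑' j, β j) * ‖v‖ ^ 2) := by
  have hm := (measurable_paramFun lam β f hs v).enorm.pow_const 2
  have hm2 : Measurable fun x => ∫⁻ p, ‖paramFun lam β f s v x p‖ₑ ^ 2 ∂(leb n) :=
    hm.lintegral_prod_right'
  have hp (x : Param n) : ∫⁻ p, 4 * ‖paramFun lam β f s v x p‖ₑ ^ 2 ∂(leb n) =
      4 * ∫⁻ p, ‖paramFun lam β f s v x p‖ₑ ^ 2 ∂(leb n) := by
    have hx : Measurable fun p => paramFun lam β f s v x p :=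
      (measurable_paramFun lam β f hs v).of_uncurry_left
    exact lintegral_const_mul 4 (hx.enorm.pow_const 2)
  refine (lintegral_mono fun x => (lintegral_mono fun p =>
    enorm_symbS_mul_sq_le c lam _ _ _).trans_eq (hp x)).trans ?_
  rw [lintegral_const_mul _ hm2]
  exact mul_le_mul_right (lintegral_paramFun_le h0 hβ hβs hf hs v) _

theorem eLpNorm_symbS_mul_paramFun_le (h0 : 0 ≤ lam) (hβ : ∀ j, 0 ≤ β j) (hβs : Summable β)
    (hf : ∀ j, ‖f j‖ = 1) (hs : Measurable s) (c : ℝ) (v : H n) :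
    eLpNorm (Function.uncurry fun (x : Param n) p =>
      symbS n c lam x.2.1 p * paramFun lam β f s v x p) 2 ((paramMeasure n).prod (leb n)) ≤
      ENNReal.ofReal (2 * Real.sqrt (∑' j, β j) * ‖v‖) := by
  have hm := measurable_symbS_mul_paramFun c lam β f hs v
  have h4 : ENNReal.ofReal (2 * Real.sqrt (∑' j, β j) * ‖v‖) ^ 2 =
      4 * ENNReal.ofReal ((∑' j, β j) * ‖v‖ ^ 2) := by
    rw [← ENNReal.ofReal_pow (by positivity), mul_pow, mul_pow, Real.sq_sqrt (tsum_nonneg hβ),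
      mul_assoc, ENNReal.ofReal_mul (by norm_num)]
    norm_num
  rw [← ENNReal.pow_le_pow_left_iff two_ne_zero, eLpNorm_two_sq,
    lintegral_prod _ (hm.enorm.pow_const 2).aemeasurable, h4]
  exact lintegral_symbS_mul_paramFun_le h0 hβ hβs hf hs c v

/-- Additivity in `v`, up to a null set of momenta `p`, holds for every parameter: `v` enters through an
invertible affine substitution of `p`. -/
theorem paramFun_add (h0 : 0 ≤ lam) (h1 : lam < 1) (v v' : H n) (x : Param n) :
    paramFun lam β f s (v + v') x =ᵐ[leb n]
      fun p => paramFun lam β f s v x p + paramFun lam β f s v' x p := by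
  filter_upwards [(quasiMeasurePreserving_fst_collide h0 h1 x.2.1 (s x.2.2)).ae_eq_comp
    (Lp.coeFn_add v v')] with p hp
  simp only [Function.comp_apply, Pi.add_apply] at hp
  simp only [paramFun, collisionFun, hp]
  ring

theorem paramFun_smul (h0 : 0 ≤ lam) (h1 : lam < 1) (a : ℂ) (v : H n) (x : Param n) :
    paramFun lam β f s (a • v) x =ᵐ[leb n] fun p => a * paramFun lam β f s v x p := by
  filter_upwards [(quasiMeasurePreserving_fst_collide h0 h1 x.2.1 (s x.2.2)).ae_eq_comp
    (Lp.coeFn_smul a v)] with p hp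
  simp only [Function.comp_apply, Pi.smul_apply, smul_eq_mul] at hp
  simp only [paramFun, collisionFun, hp]
  ring

theorem memLp_symbS_mul_paramFun (h0 : 0 ≤ lam) (hβ : ∀ j, 0 ≤ β j) (hβs : Summable β)
    (hf : ∀ j, ‖f j‖ = 1) (hs : Measurable s) (c : ℝ) (v : H n) :
    MemLp (Function.uncurry fun (x : Param n) p =>
      symbS n c lam x.2.1 p * paramFun lam β f s v x p) 2 ((paramMeasure n).prod (leb n)) :=
  ⟨(measurable_symbS_mul_paramFun c lam β f hs v).aestronglyMeasurable,
    (eLpNorm_symbS_mul_paramFun_le h0 hβ hβs hf hs c v).trans_lt ENNReal.ofReal_lt_top⟩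

/-- The vectors `S_λ m U v`, as functions of the parameters, depend boundedly on `v` in the
vector-valued `L²` space. -/
theorem exists_clm_opSMU (h0 : 0 ≤ lam) (h1 : lam < 1) (hβ : ∀ j, 0 ≤ β j) (hβs : Summable β)
    (hf : ∀ j, ‖f j‖ = 1) (hs : Measurable s) (c : ℝ) :
    ∃ A : H n →L[ℂ] Lp (H n) 2 (paramMeasure n), ∀ v, A v =ᵐ[paramMeasure n]
      fun x => opSMU c lam (β x.1) (f x.1) x.2.1 (s x.2.2) v := by
  have hslice := fun v => memLp_toL2 (measurable_symbS_mul_paramFun c lam β f hs v)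
    (memLp_symbS_mul_paramFun h0 hβ hβs hf hs c v)
  obtain ⟨A, hA⟩ := exists_clm_coeFn_ae_eq (μ := paramMeasure n)
    (fun x v => toL2 fun p => symbS n c lam x.2.1 p * paramFun lam β f s v x p)
    (2 * Real.sqrt (∑' j, β j)) (by positivity) (fun v => (hslice v).1.1)
    (fun v => (hslice v).2.trans_le (eLpNorm_symbS_mul_paramFun_le h0 hβ hβs hf hs c v))
    (fun v v' => by
      filter_upwards [ae_memLp_paramFun h0 hβ hβs hf hs v,
        ae_memLp_paramFun h0 hβ hβs hf hs v'] with x hv hv'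
      rw [← toL2_add (memLp_symbS_mul c lam _ hv) (memLp_symbS_mul c lam _ hv')]
      apply toL2_congr
      filter_upwards [paramFun_add h0 h1 v v' x] with p hp
      rw [hp, mul_add])
    (fun a v => by
      filter_upwards [ae_memLp_paramFun h0 hβ hβs hf hs v] with x hv
      rw [← toL2_const_mul a (memLp_symbS_mul c lam _ hv)]
      apply toL2_congr
      filter_upwards [paramFun_smul h0 h1 a v x] with p hp
      rw [hp, mul_left_comm])
  refine ⟨A, fun v => ?_⟩
  filter_upwards [hA v, ae_opSMU_eq h0 h1 hβ hβs hf hs c v] with x h2 h3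
  rw [h2, h3]

end Parameters

/-! ### The integral of the forms -/

section FormIntegral

theorem integral_inner_prod {S V : Type} [MeasurableSpace S] [NormedAddCommGroup V]
    [InnerProductSpace ℂ V] [CompleteSpace V] {κ : Measure S} [SFinite κ] {u u' : S → V}
    (hu : Integrable u κ) (hu' : Integrable u' κ) :
    ∫ z, ⟪u z.1, u' z.2⟫_ℂ ∂(κ.prod κ) = ⟪∫ s, u s ∂κ, ∫ s, u' s ∂κ⟫_ℂ := by
  have hint : Integrable (fun z : S × S => ⟪u z.1, u' z.2⟫_ℂ) (κ.prod κ) :=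
    (hu.norm.mul_prod hu'.norm).mono' (hu.1.comp_fst.inner hu'.1.comp_snd)
      (Eventually.of_forall fun z => norm_inner_le_norm _ _)
  rw [integral_prod _ hint]
  simp only [integral_inner hu']
  rw [← inner_conj_symm, ← integral_inner hu, ← integral_conj]
  simp only [inner_conj_symm]

variable {n : ℕ}

theorem lintegral_collisionFun_prod {lam : ℝ} (h0 : 0 ≤ lam) {β : ℝ} (hβ : 0 ≤ β) (v f : H n) :
    ∫⁻ k, ∫⁻ σ, ∫⁻ p, ‖collisionFun lam β v f k σ p‖ₑ ^ 2 ∂(leb n) ∂(haarRot n) ∂(leb n) ≠ ∞ := by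
  have hm : Measurable fun z : (E n × rotations n) × E n =>
      ‖collisionFun lam β v f z.1.1 z.1.2 z.2‖ₑ ^ 2 :=
    ((measurable_collisionFun lam β v f).comp
      (f := fun z : (E n × rotations n) × E n => ((z.2, z.1.1), z.1.2)) (by fun_prop)).enorm.pow_const 2
  have hm2 : Measurable fun z : E n × rotations n =>
      ∫⁻ p, ‖collisionFun lam β v f z.1 z.2 p‖ₑ ^ 2 ∂(leb n) := hm.lintegral_prod_right'
  rw [lintegral_lintegral_swap (f := fun k σ =>
    ∫⁻ p, ‖collisionFun lam β v f k σ p‖ₑ ^ 2 ∂(leb n)) hm2.aemeasurable]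
  simp only [lintegral_collisionFun h0 hβ, lintegral_const, measure_univ, mul_one]
  exact ENNReal.ofReal_ne_top

/-- Averaged over the rotations, the vectors `S_λ m U v` are the slices of `√β 𝐀_λ (v ⊗ f)`. -/
theorem integral_opSMU [NeZero n] {lam : ℝ} (h0 : 0 ≤ lam) (h1 : lam < 1) (c : ℝ) {β : ℝ}
    (hβ : 0 ≤ β) (v f : H n) :
    ∀ᵐ k ∂(leb n), Integrable (fun σ => opSMU c lam β f k σ v) (haarRot n) ∧
      ∫ σ, opSMU c lam β f k σ v ∂(haarRot n) =
        (Real.sqrt β : ℂ) • toL2 fun p => transOp n c lam h0 (tmul (leb n) (leb n) v f) (p, k) := by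
  set Φ := transOp n c lam h0 (tmul (leb n) (leb n) v f) with hΦ
  have hm (k : E n) : Measurable (Function.uncurry fun σ p => collisionFun lam β v f k σ p) :=
    (measurable_collisionFun lam β v f).comp
      (f := fun z : rotations n × E n => ((z.2, k), z.1)) (by fun_prop)
  have hm3 : Measurable fun z : (E n × rotations n) × E n =>
      ‖collisionFun lam β v f z.1.1 z.1.2 z.2‖ₑ ^ 2 :=
    ((measurable_collisionFun lam β v f).comp
      (f := fun z : (E n × rotations n) × E n => ((z.2, z.1.1), z.1.2)) (by fun_prop)).enorm.pow_const 2
  have hm2 : Measurable fun z : E n × rotations n =>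
      ∫⁻ p, ‖collisionFun lam β v f z.1 z.2 p‖ₑ ^ 2 ∂(leb n) := hm3.lintegral_prod_right'
  have hval : Φ =ᵐ[(leb n).prod (leb n)] fun z => symbS n c lam z.2 z.1 *
      ∫ σ, v (collide lam (z, σ)).1 * f (collide lam (z, σ)).2 ∂(haarRot n) := by
    rw [hΦ, transOp_eq_avgOp]
    exact coeFn_avgOp_of_ae (memLp_symbS n c lam) (measurePreserving_collide_prod (by positivity))
      (coeFn_tmul (leb n) (leb n) v f)
  have hval' := Measure.ae_ae_of_ae_prod ((Measure.measurePreserving_swap (μ := leb n)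
    (ν := leb n)).quasiMeasurePreserving.ae_eq_comp hval)
  filter_upwards [ae_lt_top hm2.lintegral_prod_right' (lintegral_collisionFun_prod h0 hβ v f),
    hval', ae_memLp_slice (memLp_heavySlice Φ)] with k hk hΦk hslice
  have hmem : MemLp (Function.uncurry fun σ p => collisionFun lam β v f k σ p) 2
      ((haarRot n).prod (leb n)) := by
    rw [memLp_two_iff_lintegral (hm k).aestronglyMeasurable,
      lintegral_prod _ ((hm k).enorm.pow_const 2).aemeasurable]
    exact hk
  have hS : Measurable fun z : rotations n × E n => symbS n c lam k z.2 :=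
    (measurable_symbS n c lam).comp (f := fun z : rotations n × E n => (z.2, k)) (by fun_prop)
  have hF : Measurable (Function.uncurry fun σ p =>
      symbS n c lam k p * collisionFun lam β v f k σ p) := hS.mul (hm k)
  have hFmem : MemLp (Function.uncurry fun σ p =>
      symbS n c lam k p * collisionFun lam β v f k σ p) 2 ((haarRot n).prod (leb n)) := by
    refine hmem.of_le_mul (c := 2) hF.aestronglyMeasurable (Eventually.of_forall fun z => ?_)
    simp only [Function.uncurry, norm_mul]
    exact mul_le_mul_of_nonneg_right (norm_scatCoeff_le _ _ _ _) (norm_nonneg _)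
  have heq : (fun σ => opSMU c lam β f k σ v) =ᵐ[haarRot n]
      fun σ => toL2 fun p => symbS n c lam k p * collisionFun lam β v f k σ p := by
    filter_upwards [ae_memLp_slice hmem] with σ hσ
    exact opSMU_eq_toL2 h0 h1 c β f k σ v hσ
  refine ⟨((memLp_toL2 hF hFmem).1.integrable (by norm_num)).congr heq.symm, ?_⟩
  rw [integral_congr_ae heq, integral_toL2 hF hFmem,
    ← toL2_const_mul (g := fun p => Φ (p, k)) _ hslice]
  apply toL2_congr
  filter_upwards [hΦk] with p hp
  simp only [Function.comp_apply, Prod.swap_prod_mk] at hp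
  rw [hp]
  simp only [collisionFun, integral_const_mul]
  ring

/-- The integral of the forms over the light momentum and the two rotations. -/
theorem integral_form [NeZero n] {lam : ℝ} (h0 : 0 ≤ lam) (h1 : lam < 1) (c : ℝ) {β : ℝ}
    (hβ : 0 ≤ β) (f : H n) (G : H n →L[ℂ] H n) (v w : H n)
    (hint : Integrable (fun y : E n × rotations n × rotations n =>
      ⟪opSMU c lam β f y.1 y.2.1 v, G (opSMU c lam β f y.1 y.2.2 w)⟫_ℂ)
      ((leb n).prod ((haarRot n).prod (haarRot n)))) :
    ∫ y : E n × rotations n × rotations n,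
      ⟪opSMU c lam β f y.1 y.2.1 v, G (opSMU c lam β f y.1 y.2.2 w)⟫_ℂ
      ∂((leb n).prod ((haarRot n).prod (haarRot n))) =
    β * ⟪transOp n c lam h0 (tmul (leb n) (leb n) v f),
      tensorOp (leb n) (leb n) G 1 (transOp n c lam h0 (tmul (leb n) (leb n) w f))⟫_ℂ := by
  rw [integral_prod _ hint, inner_tensorOp_eq_integral, ← integral_const_mul]
  apply integral_congr_ae
  filter_upwards [integral_opSMU h0 h1 c hβ v f, integral_opSMU h0 h1 c hβ w f]
    with k ⟨hv, hv'⟩ ⟨hw, hw'⟩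
  have e : ∫ z : rotations n × rotations n,
      ⟪opSMU c lam β f k z.1 v, G (opSMU c lam β f k z.2 w)⟫_ℂ ∂((haarRot n).prod (haarRot n)) =
      ⟪∫ σ, opSMU c lam β f k σ v ∂(haarRot n), ∫ σ, G (opSMU c lam β f k σ w) ∂(haarRot n)⟫_ℂ :=
    integral_inner_prod hv (G.integrable_comp hw)
  rw [e, G.integral_comp_comm hw, hv', hw', map_smul,
    inner_smul_left, inner_smul_right, Complex.conj_ofReal, ← mul_assoc, ← Complex.ofReal_mul,
    Real.mul_self_sqrt hβ]

end FormIntegral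

end PointScattering

end

theorem mainTheorem2 (n : ℕ) [NeZero n] (hn : n ≤ 3) (c lam : ℝ) (hlam : 0 ≤ lam) (hlam1 : lam < 1)
    (ρ : PointScattering.H n →L[ℂ] PointScattering.H n)
    (β : ℕ → ℝ) (f : ℕ → PointScattering.H n)
    (hβ : ∀ j, 0 ≤ β j) (hβs : Summable β) (hf : Orthonormal ℂ f)
    (hρ : HasSum (fun j => (β j : ℂ) • InnerProductSpace.rankOne ℂ (f j) (f j)) ρ)
    (G : PointScattering.H n →L[ℂ] PointScattering.H n) :
    (∀ (j : ℕ) (σ : PointScattering.rotations n) (w : PointScattering.H n),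
      ∀ᵐ k ∂(PointScattering.leb n), PointScattering.InMulDomain
        (PointScattering.symbM lam (β j) (f j) k σ) (PointScattering.opU lam k σ w)) ∧
    ∃ B : PointScattering.H n →L[ℂ] PointScattering.H n,
      PointScattering.IsPartialTrace (PointScattering.leb n) (PointScattering.leb n)
        (PointScattering.tensorOp (PointScattering.leb n) (PointScattering.leb n) 1 ρ ∘L
          ContinuousLinearMap.adjoint (PointScattering.transOp n c lam hlam) ∘L
          PointScattering.tensorOp (PointScattering.leb n) (PointScattering.leb n) G 1 ∘L
          PointScattering.transOp n c lam hlam) B ∧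
      PointScattering.IsStrongIntegral (PointScattering.paramMeasure n)
        (fun x v w => ⟪PointScattering.opSMU c lam (β x.1) (f x.1) x.2.1 x.2.2.1 v,
          G (PointScattering.opSMU c lam (β x.1) (f x.1) x.2.1 x.2.2.2 w)⟫_ℂ) B := by
  refine ⟨fun j σ w => PointScattering.ae_inMulDomain hlam hlam1 (hβ j) (f j) σ w, ?_⟩
  obtain ⟨A₁, hA₁⟩ := PointScattering.exists_clm_opSMU (s := Prod.fst) hlam hlam1 hβ hβs hf.1
    measurable_fst c
  obtain ⟨A₂, hA₂⟩ := PointScattering.exists_clm_opSMU (s := Prod.snd) hlam hlam1 hβ hβs hf.1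
    measurable_snd c
  obtain ⟨B, hB⟩ := PointScattering.exists_isStrongIntegral _ _ A₁ A₂ hA₁ hA₂ G
  refine ⟨B, ?_, hB⟩
  apply PointScattering.isPartialTrace_of_inner_eq hβ hβs hf hρ
  intro v w
  have hint := hB.1 v w
  rw [hB.2.1 v w]
  rw [PointScattering.paramMeasure] at hint ⊢
  rw [integral_prod _ hint, integral_countable]
  · refine tsum_congr fun j => ?_
    have hj := (ae_iff_of_countable.1 hint.prod_right_ae) j (by simp)
    have h := PointScattering.integral_form hlam hlam1 c (hβ j) (f j) G v w hj
    rw [ContinuousLinearMap.comp_apply, ContinuousLinearMap.adjoint_inner_right]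
    simp only [Measure.real, Measure.count_singleton, ENNReal.toReal_one, one_smul]
    exact h
  · exact hint.integral_prod_left
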